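/- Let $\mathbb{N}=\{1,2,\dots\}$, $p\ge 0$ and $\varepsilon>0$, and put $\sigma_i^2=\varepsilon^2 i^{2p}$ for $i\in\mathbb{N}$. For $\theta\in\ell_2=\ell_2(\mathbb{N})$ let $\mathrm{P}_\theta=\bigotimes_{i} N(\theta_i,\sigma_i^2)$ be the law of the data $X=(X_i)_{i\in\mathbb{N}}$, and let $\mathrm{E}_\theta$ be the corresponding expectation. Let $\|\cdot\|$ be the $\ell_2$-norm, let $\varphi(x,\mu,v)$ be the density at $x$ of $N(\mu,v)$, and let $N(\mu,0)$ be the Dirac measure at $\mu$. For $K,\alpha>0$ and $i,I,n\in\mathbb{N}$ put $L=\frac{K}{K+1}$, $X_i(I)=X_i 1\{i\le I\}$, $\tau_i^2(I)=K\sigma_i^2 1\{i\le I\}$, $\lambda_I=(e^\alpha-1)e^{-\alpha I}$, and $$\mathrm{P}_I(\cdot|X)=\bigotimes_i N\big(X_i(I),\,L\sigma_i^2 1\{i\le I\}\big),\qquad \mathrm{P}_n(\mathcal{I}=I|X)=\frac{\lambda_I\prod_{i=1}^n\varphi(X_i,X_i(I),\tau_i^2(I)+\sigma_i^2)}{\sum_{J}\lambda_J\prod_{i=1}^n\varphi(X_i,X_i(J),\tau_i^2(J)+\sigma_i^2)}.$$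 Define the mixture data dependent measure (DDM) $$\mathrm{P}(\cdot|X)=\sum_{I\in\mathbb{N}}\mathrm{P}_I(\cdot|X)\,\mathrm{P}(\mathcal{I}=I|X),\qquad \mathrm{P}(\mathcal{I}=I|X)=\lim_{n\to\infty}\mathrm{P}_n(\mathcal{I}=I|X),$$ and the oracle rate $r(\theta)\ge 0$ by $r^2(\theta)=\min_{I\in\mathbb{N}}\big(\sum_{i\le I}\sigma_i^2+\sum_{i>I}\theta_i^2\big)$. **Theorem (upper bound).** Let $p\ge 0$, $K\ge 1.87$ and $\alpha>0$. There is a constant $C_{or}$, depending only on $K$, $\alpha$ and the degree of ill-posedness $p$, such that the following holds for every $\varepsilon>0$ and every $\theta_0\in\ell_2$. The limits defining $\mathrm{P}(\mathcal{I}=I|X)$, $I\in\mathbb{N}$, exist $\mathrm{P}_{\theta_0}$-almost surely; the DDM $\mathrm{P}(\cdot|X)$ depends measurably on $X$ and is $\mathrm{P}_{\theta_0}$-almost surely a probability measure concentrated on $\ell_2$; and for every $M>0$ $$\mathrm{E}_{\theta_0}\,\mathrm{P}\big(\|\theta-\theta_0\|\ge M\,r(\theta_0)\,\big|\,X\big)\le\frac{C_{or}}{M^2}.$$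 -/

import Mathlib

open Filter Topology MeasureTheory ProbabilityTheory
open scoped ENNReal

namespace SignalDDM

noncomputable section

/-- The sequence space `ℓ₂`, with coordinates indexed by `1, 2, 3, …`. -/
abbrev EllTwo : Type := lp (fun _ : ℕ+ => ℝ) 2

/-- The noise variances `σ_i² = ε² i^{2p}` of the mildly ill-posed model. -/
def noiseVar (p ε : ℝ) (i : ℕ+) : ℝ := ε ^ 2 * (i : ℝ) ^ (2 * p)

/-- The law `P_θ = ⨂_i N(θ_i, σ_i²)` of the observed sequence `X`. -/
def dataLaw (p ε : ℝ) (θ : ℕ+ → ℝ) : Measure (ℕ+ → ℝ) :=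
  Measure.infinitePi fun i => gaussianReal (θ i) (noiseVar p ε i).toNNReal

/-- The truncated data `X(I) = (X_i 1{i ≤ I})_i`. -/
def trunc (I : ℕ+) (X : ℕ+ → ℝ) (i : ℕ+) : ℝ := if i ≤ I then X i else 0

/-- The prior variances `τ_i²(I) = K σ_i² 1{i ≤ I}`. -/
def priorVar (p ε K : ℝ) (I i : ℕ+) : ℝ := if i ≤ I then K * noiseVar p ε i else 0

/-- The prior weights `λ_I = (e^α - 1) e^{-α I}`; they sum to one over `I ≥ 1`. -/
def priorWeight (α : ℝ) (I : ℕ+) : ℝ := (Real.exp α - 1) * Real.exp (-α * (I : ℝ))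

/-- `λ_I ∏_{i ≤ n} φ(X_i, X_i(I), τ_i²(I) + σ_i²)`, where `φ(x, μ, v)` is the density at `x` of the
normal distribution with mean `μ` and variance `v`. -/
def unnormWeight (p ε K α : ℝ) (n I : ℕ+) (X : ℕ+ → ℝ) : ℝ :=
  priorWeight α I * ∏ i ∈ Finset.Iic n,
    gaussianPDFReal (trunc I X i) (priorVar p ε K I i + noiseVar p ε i).toNNReal (X i)

/-- The weight `P_n(𝓘 = I | X)` computed from the first `n` coordinates of the data. -/
def weightUpTo (p ε K α : ℝ) (n I : ℕ+) (X : ℕ+ → ℝ) : ℝ :=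
  unnormWeight p ε K α n I X / ∑' J : ℕ+, unnormWeight p ε K α n J X

/-- The weight `P(𝓘 = I | X)`, the limit of `P_n(𝓘 = I | X)` as `n → ∞`. -/
def weight (p ε K α : ℝ) (I : ℕ+) (X : ℕ+ → ℝ) : ℝ :=
  limUnder atTop fun n : ℕ+ => weightUpTo p ε K α n I X

/-- `P_I(· | X) = ⨂_i N(X_i(I), L σ_i² 1{i ≤ I})` with `L = K / (K + 1)`; a normal distribution
with variance zero is a Dirac measure. -/
def componentMeasure (p ε K : ℝ) (I : ℕ+) (X : ℕ+ → ℝ) : Measure (ℕ+ → ℝ) :=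
  Measure.infinitePi fun i =>
    gaussianReal (trunc I X i) (if i ≤ I then K / (K + 1) * noiseVar p ε i else 0).toNNReal

/-- The mixture data dependent measure `P(· | X) = ∑_I P_I(· | X) P(𝓘 = I | X)`. -/
def ddm (p ε K α : ℝ) (X : ℕ+ → ℝ) : Measure (ℕ+ → ℝ) :=
  Measure.sum fun I : ℕ+ => ENNReal.ofReal (weight p ε K α I X) • componentMeasure p ε K I X

/-- The `ℓ₂`-norm `(∑_i x_i²)^{1/2}` of a real sequence, equal to `∞` outside `ℓ₂`. -/
def ellTwoNorm (x : ℕ+ → ℝ) : ℝ≥0∞ := (∑' i, ENNReal.ofReal (x i ^ 2)) ^ (1 / 2 : ℝ)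

/-- `r²(I, θ) = ∑_{i ≤ I} σ_i² + ∑_{i > I} θ_i²`. -/
def rateSq (p ε : ℝ) (θ : EllTwo) (I : ℕ+) : ℝ :=
  ∑ i ∈ Finset.Iic I, noiseVar p ε i + ∑' i : Set.Ioi I, θ i ^ 2

/-- The oracle rate `r(θ)`, where `r²(θ) = min_I r²(I, θ)` over `I ≥ 1`. For `ε > 0` and `p ≥ 0` the
minimum exists, because `r²(I, θ) → ∞` as `I → ∞`. -/
def oracleRate (p ε : ℝ) (θ : EllTwo) : ℝ := Real.sqrt (⨅ I : ℕ+, rateSq p ε θ I)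

end

end SignalDDM

namespace SignalDDM

/-! After cancelling a factor common to all models, the weight of `I` is proportional to `exp
(logWeight I)`, so for `0 ≤ h ≤ 1` it is at most the `h`-th power of the odds of `I` against any
reference model `I₀` (`weight_le_exp`). Expected powers of the odds are products of Gaussian
integrals (`lintegral_odds_larger_le`).

Let `I₀` minimize noise plus `h⁻¹` times squared bias, with `h = min (1/2) (α/4)`; this costs a
factor `h⁻¹` against the oracle (`exists_reference`). Above `I₀`, minimality and summation by parts
bound the signal-to-noise sum by `h (I - I₀)`. As `log (K + 1) ≥ 1`, the first-order terms in `h`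
coming from the noise cancel, and the expected `h`-th power of the odds decays like `exp (-(hα/2)(I
- I₀))`. This gives summable weights almost surely, hence the limits, and beats the polynomial
growth of the accumulated noise (`lintegral_noise_le`).

Below `I₀` only extra bias matters. The expected odds are exponentially small in the extra bias
divided by `σ²_{I₀}`, up to a term linear in `I₀ - I`. Each smaller model therefore costs
`O(σ²_{I₀})` beyond a threshold of order `I₀ σ²_{I₀}`, and `I₀ σ²_{I₀}` is comparable to the
accumulated noise (`lintegral_bias_le`). Markov's inequality for the squared norm concludes. -/

lemma noiseVar_pos {p ε : ℝ} (hε : 0 < ε) (i : ℕ+) : 0 < noiseVar p ε i := by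
  have : (0 : ℝ) < i := by exact_mod_cast i.pos
  unfold noiseVar
  positivity

/-! ### Closed form and limits of the posterior weights -/

/-- The logarithm of the evidence in favour of including the coordinate `i`. -/
noncomputable def logFactor (p ε K : ℝ) (X : ℕ+ → ℝ) (i : ℕ+) : ℝ :=
  X i ^ 2 / (2 * noiseVar p ε i) - Real.log (K + 1) / 2

/-- The logarithm of the posterior weight of the model `I`, up to normalization. -/
noncomputable def logWeight (p ε K α : ℝ) (X : ℕ+ → ℝ) (I : ℕ+) : ℝ :=
  -α * I + ∑ i ∈ Finset.Iic I, logFactor p ε K X i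

/-- A normal density at its own mean is just its normalization. Freeing a coordinate thus gains
`x²/(2v)` in the exponent and pays `log (K + 1) / 2` for the larger variance. -/
lemma gaussianPDFReal_factor {K v : ℝ} (hK : 0 < K) (hv : 0 < v) (x : ℝ) :
    gaussianPDFReal x (K * v + v).toNNReal x =
      gaussianPDFReal 0 v.toNNReal x * Real.exp (x ^ 2 / (2 * v) - Real.log (K + 1) / 2) := by
  have h1 : (0 : ℝ) < K * v + v := by positivity
  have h2 : Real.exp (Real.log (K + 1) / 2) = √(K + 1) := by
    rw [← Real.log_sqrt (by positivity), Real.exp_log (by positivity)]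
  simp only [gaussianPDFReal_def, Real.coe_toNNReal _ h1.le, Real.coe_toNNReal _ hv.le]
  rw [sub_self, Real.exp_sub, h2, show K * v + v = v * (K + 1) by ring, ← mul_assoc,
    Real.sqrt_mul (by positivity) (K + 1)]
  have h3 : Real.exp (-(x - 0) ^ 2 / (2 * v)) * Real.exp (x ^ 2 / (2 * v)) = 1 := by
    rw [← Real.exp_add, sub_zero, neg_div, neg_add_cancel, Real.exp_zero]
  have h4 : √(K + 1) ≠ 0 := by positivity
  have h5 : √(2 * Real.pi * v) ≠ 0 := by positivity
  field_simp
  simpa [← neg_div] using h3.symm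

/-- The first factor does not involve `I` and cancels on normalization; `min n I` appears because
only `n` coordinates have been seen. -/
lemma unnormWeight_eq {p ε K α : ℝ} (hK : 0 < K) (hε : 0 < ε) (n I : ℕ+) (X : ℕ+ → ℝ) :
    unnormWeight p ε K α n I X =
      ((Real.exp α - 1) * ∏ i ∈ Finset.Iic n, gaussianPDFReal 0 (noiseVar p ε i).toNNReal (X i)) *
        Real.exp (-α * I + ∑ i ∈ Finset.Iic (min n I), logFactor p ε K X i) := by
  have h : ∀ i ∈ Finset.Iic n,
      gaussianPDFReal (trunc I X i) (priorVar p ε K I i + noiseVar p ε i).toNNReal (X i) =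
      gaussianPDFReal 0 (noiseVar p ε i).toNNReal (X i) *
        (if i ≤ I then Real.exp (logFactor p ε K X i) else 1) := by
    intro i _
    unfold trunc priorVar logFactor
    split_ifs
    · exact gaussianPDFReal_factor hK (noiseVar_pos hε i) _
    · simp
  have h2 : (Finset.Iic n).filter (· ≤ I) = Finset.Iic (min n I) := by
    ext i; simp
  rw [unnormWeight, Finset.prod_congr rfl h, Finset.prod_mul_distrib, ← Finset.prod_filter, h2,
    Real.exp_add, Real.exp_sum, priorWeight]
  ring

lemma prod_gaussianPDFReal_pos {p ε α : ℝ} (hα : 0 < α) (hε : 0 < ε) (n : ℕ+) (X : ℕ+ → ℝ) :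
    0 < (Real.exp α - 1) *
      ∏ i ∈ Finset.Iic n, gaussianPDFReal 0 (noiseVar p ε i).toNNReal (X i) := by
  refine mul_pos (by simpa using hα) (Finset.prod_pos fun i _ => gaussianPDFReal_pos _ _ _ ?_)
  simpa using noiseVar_pos hε i

lemma weightUpTo_eq {p ε K α : ℝ} (hK : 0 < K) (hα : 0 < α) (hε : 0 < ε) (n I : ℕ+)
    (X : ℕ+ → ℝ) :
    weightUpTo p ε K α n I X =
      Real.exp (-α * I + ∑ i ∈ Finset.Iic (min n I), logFactor p ε K X i) /
        ∑' J : ℕ+, Real.exp (-α * J + ∑ i ∈ Finset.Iic (min n J), logFactor p ε K X i) := by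
  simp only [weightUpTo, unnormWeight_eq hK hε, tsum_mul_left]
  exact mul_div_mul_left _ _ (prod_gaussianPDFReal_pos hα hε n X).ne'

lemma summable_exp_neg_mul {α : ℝ} (hα : 0 < α) : Summable fun J : ℕ+ => Real.exp (-α * (J : ℝ)) := by
  have h : Summable fun n : ℕ => Real.exp (n * -α) :=
    Real.summable_exp_nat_mul_iff.mpr (by linarith)
  simpa [mul_comm, Function.comp_def] using h.comp_injective PNat.coe_injective

/-- If the limiting weights are summable, the normalizing constants converge. -/
lemma tendsto_normalizer {α : ℝ} (hα : 0 < α) (g : ℕ+ → ℝ)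
    (hs : Summable fun J : ℕ+ => Real.exp (-α * J + g J)) :
    Tendsto (fun n : ℕ+ => ∑' J : ℕ+, Real.exp (-α * J + g (min n J))) atTop
      (𝓝 (∑' J : ℕ+, Real.exp (-α * J + g J))) := by
  set b : ℕ+ → ℝ := fun J => Real.exp (-α * J + g J) with hb
  set S : ℝ := ∑' J : ℕ+, Real.exp (-α * (J : ℝ)) with hS
  have hb0 : ∀ J, 0 < b J := fun J => Real.exp_pos _
  have hα_sum := summable_exp_neg_mul hα
  -- Models beyond `n` share the evidence of model `n` and differ only in the prior. Their total is
  -- at most `b n` times a fixed constant, which vanishes since `b` is summable.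
  have htail : ∀ n J : ℕ+, n < J →
      Real.exp (-α * J + g (min n J)) = b n * Real.exp (-α * ((J - n : ℕ+) : ℝ)) := by
    intro n J hJ
    rw [min_eq_left hJ.le, hb, ← Real.exp_add]
    congr 1
    have : ((J - n : ℕ+) : ℝ) = J - n := by
      rw [show ((J - n : ℕ+) : ℝ) = (((J - n : ℕ+) : ℕ) : ℝ) from rfl, PNat.sub_coe, if_pos hJ,
        Nat.cast_sub (by exact_mod_cast hJ.le)]
    rw [this]; ring
  have hmaj : ∀ n J : ℕ+, Real.exp (-α * J + g (min n J)) =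
      (Set.Iic n).indicator b J +
        b n * (Set.Ioi n).indicator (fun J : ℕ+ => Real.exp (-α * ((J - n : ℕ+) : ℝ))) J := by
    intro n J
    rcases le_or_gt J n with h | h
    · simp [Set.indicator, h, hb, not_lt.mpr h]
    · rw [htail n J h]
      simp [Set.indicator, h, not_le.mpr h]
  have hshift : ∀ n : ℕ+, Summable ((Set.Ioi n).indicator
      (fun J : ℕ+ => Real.exp (-α * ((J - n : ℕ+) : ℝ)))) ∧
      ∑' J, (Set.Ioi n).indicator (fun J : ℕ+ => Real.exp (-α * ((J - n : ℕ+) : ℝ))) J ≤ S := by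
    intro n
    have hinj : Function.Injective (fun J : Set.Ioi n => (J : ℕ+) - n) := by
      rintro ⟨a, ha⟩ ⟨c, hc⟩ h
      simp only [Set.mem_Ioi] at ha hc
      simp only at h
      have h1 := PNat.sub_add_of_lt ha
      have h2 := PNat.sub_add_of_lt hc
      rw [h] at h1
      exact Subtype.ext (h1.symm.trans h2)
    have h1 := hα_sum.comp_injective hinj
    refine ⟨summable_subtype_iff_indicator.mp h1, ?_⟩
    rw [← tsum_subtype]
    exact tsum_comp_le_tsum_of_inj hα_sum (fun _ => (Real.exp_pos _).le) hinj
  have hsplit : ∀ n : ℕ+, ∑' J : ℕ+, Real.exp (-α * J + g (min n J)) =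
      ∑' J, (Set.Iic n).indicator b J + b n * ∑' J, (Set.Ioi n).indicator
        (fun J : ℕ+ => Real.exp (-α * ((J - n : ℕ+) : ℝ))) J := by
    intro n
    rw [← tsum_mul_left, ← (hs.indicator _).tsum_add ((hshift n).1.mul_left _)]
    exact tsum_congr (hmaj n)
  simp only [hsplit]
  have hlim1 : Tendsto (fun n : ℕ+ => ∑' J, (Set.Iic n).indicator b J) atTop (𝓝 (∑' J, b J)) := by
    refine tendsto_tsum_of_dominated_convergence hs (fun J => ?_) (Eventually.of_forall ?_)
    · refine tendsto_const_nhds.congr' ?_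
      filter_upwards [eventually_ge_atTop J] with n hn
      simp [Set.indicator, hn]
    · intro n J
      rw [Real.norm_eq_abs, abs_of_nonneg (Set.indicator_nonneg (fun _ _ => (hb0 _).le) _)]
      exact Set.indicator_le_self' (fun _ _ => (hb0 _).le) J
  have hb_lim : Tendsto b atTop (𝓝 0) :=
    hs.tendsto_cofinite_zero.mono_left atTop_le_cofinite
  have hlim2 : Tendsto (fun n : ℕ+ => b n * ∑' J, (Set.Ioi n).indicator
        (fun J : ℕ+ => Real.exp (-α * ((J - n : ℕ+) : ℝ))) J) atTop (𝓝 0) := by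
    have : Tendsto (fun n => b n * S) atTop (𝓝 0) := by simpa using hb_lim.mul_const S
    refine squeeze_zero (fun n => mul_nonneg (hb0 n).le
      (tsum_nonneg fun J => Set.indicator_nonneg (fun _ _ => (Real.exp_pos _).le) _)) (fun n => ?_) this
    exact mul_le_mul_of_nonneg_left (hshift n).2 (hb0 n).le
  simpa using hlim1.add hlim2

lemma tendsto_weightUpTo {p ε K α : ℝ} (hK : 0 < K) (hα : 0 < α) (hε : 0 < ε) {X : ℕ+ → ℝ}
    (hs : Summable fun J => Real.exp (logWeight p ε K α X J)) (I : ℕ+) :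
    Tendsto (fun n : ℕ+ => weightUpTo p ε K α n I X) atTop
      (𝓝 (Real.exp (logWeight p ε K α X I) / ∑' J, Real.exp (logWeight p ε K α X J))) := by
  simp only [weightUpTo_eq hK hα hε]
  refine Tendsto.div ?_ (tendsto_normalizer hα (fun I => ∑ i ∈ Finset.Iic I, logFactor p ε K X i) hs)
    (hs.tsum_pos (fun _ => (Real.exp_pos _).le) 1 (Real.exp_pos _)).ne'
  refine tendsto_const_nhds.congr' ?_
  filter_upwards [eventually_ge_atTop I] with n hn
  rw [min_eq_right hn, logWeight]

lemma weight_eq {p ε K α : ℝ} (hK : 0 < K) (hα : 0 < α) (hε : 0 < ε) {X : ℕ+ → ℝ}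
    (hs : Summable fun J => Real.exp (logWeight p ε K α X J)) (I : ℕ+) :
    weight p ε K α I X =
      Real.exp (logWeight p ε K α X I) / ∑' J, Real.exp (logWeight p ε K α X J) :=
  (tendsto_weightUpTo hK hα hε hs I).limUnder_eq

lemma tsum_ofReal_weight {p ε K α : ℝ} (hK : 0 < K) (hα : 0 < α) (hε : 0 < ε) {X : ℕ+ → ℝ}
    (hs : Summable fun J => Real.exp (logWeight p ε K α X J)) :
    ∑' I, ENNReal.ofReal (weight p ε K α I X) = 1 := by
  have hpos := hs.tsum_pos (fun _ => (Real.exp_pos _).le) 1 (Real.exp_pos _)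
  simp only [weight_eq hK hα hε hs]
  rw [← ENNReal.ofReal_tsum_of_nonneg (fun I => by positivity) (hs.div_const _), tsum_div_const,
    div_self hpos.ne', ENNReal.ofReal_one]

lemma weight_le_one {p ε K α : ℝ} (hK : 0 < K) (hα : 0 < α) (hε : 0 < ε) {X : ℕ+ → ℝ}
    (hs : Summable fun J => Real.exp (logWeight p ε K α X J)) (I : ℕ+) :
    weight p ε K α I X ≤ 1 := by
  rw [weight_eq hK hα hε hs]
  exact div_le_one_of_le₀ (hs.le_tsum I fun _ _ => (Real.exp_pos _).le)
    (tsum_nonneg fun _ => (Real.exp_pos _).le)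

/-- A posterior probability is bounded both by 1 and by the odds against `I₀`, hence by any power of
the odds with exponent in `[0, 1]`. -/
lemma weight_le_exp {p ε K α : ℝ} (hK : 0 < K) (hα : 0 < α) (hε : 0 < ε) {X : ℕ+ → ℝ}
    (hs : Summable fun J => Real.exp (logWeight p ε K α X J)) {h : ℝ} (h0 : 0 ≤ h) (h1 : h ≤ 1)
    (I I₀ : ℕ+) :
    weight p ε K α I X ≤ Real.exp (h * (logWeight p ε K α X I - logWeight p ε K α X I₀)) := by
  rcases le_total (logWeight p ε K α X I) (logWeight p ε K α X I₀) with hle | hle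
  · have : weight p ε K α I X ≤
        Real.exp (logWeight p ε K α X I - logWeight p ε K α X I₀) := by
      rw [weight_eq hK hα hε hs, Real.exp_sub]
      exact div_le_div_of_nonneg_left (Real.exp_pos _).le (Real.exp_pos _)
        (hs.le_tsum I₀ fun _ _ => (Real.exp_pos _).le)
    refine this.trans (Real.exp_le_exp.mpr ?_)
    nlinarith
  · refine (weight_le_one hK hα hε hs I).trans (Real.one_le_exp ?_)
    exact mul_nonneg h0 (sub_nonneg.mpr hle)

/-! ### Measurability of the mixture and concentration on `ℓ₂` -/

lemma measurable_weight (p ε K α : ℝ) (I : ℕ+) : Measurable (weight p ε K α I) := by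
  have h1 : ∀ n I : ℕ+, Measurable (unnormWeight p ε K α n I) := by
    intro n I
    have h : ∀ i : ℕ+, Measurable fun X : ℕ+ → ℝ =>
        gaussianPDFReal (trunc I X i) (priorVar p ε K I i + noiseVar p ε i).toNNReal (X i) := by
      intro i
      simp only [trunc, gaussianPDFReal_def]
      split_ifs <;> fun_prop
    exact (Finset.measurable_fun_prod _ fun i _ => h i).const_mul _
  have h2 : ∀ n : ℕ+, Measurable (weightUpTo p ε K α n I) := fun n =>
    (h1 n I).div (Measurable.tsum fun J => h1 n J)
  exact (StronglyMeasurable.limUnder fun n => (h2 n).stronglyMeasurable).measurable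

/-- A fixed centred Gaussian law shifted by the truncated data: the dependence on `X` sits in the
shift alone, so measurability in `X` reduces to that of sections of a product set. -/
lemma componentMeasure_eq_map (p ε K : ℝ) (I : ℕ+) (X : ℕ+ → ℝ) :
    componentMeasure p ε K I X =
      (Measure.infinitePi fun i : ℕ+ => gaussianReal 0
        (if i ≤ I then K / (K + 1) * noiseVar p ε i else 0).toNNReal).map
        (fun z i => z i + trunc I X i) := by
  rw [Measure.infinitePi_map_pi (f := fun i x => x + trunc I X i) _ (fun i => by fun_prop)]
  simp [gaussianReal_map_add_const, componentMeasure]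

lemma measurable_componentMeasure (p ε K : ℝ) (I : ℕ+) :
    Measurable (componentMeasure p ε K I) := by
  have htr : ∀ i, Measurable fun X : ℕ+ → ℝ => trunc I X i := by
    intro i
    unfold trunc
    split_ifs <;> fun_prop
  have hmeas : Measurable fun q : (ℕ+ → ℝ) × (ℕ+ → ℝ) => fun i => q.2 i + trunc I q.1 i :=
    measurable_pi_lambda _ fun i =>
      ((measurable_pi_apply i).comp measurable_snd).add ((htr i).comp measurable_fst)
  refine Measure.measurable_of_measurable_coe _ fun s hs => ?_
  simp only [componentMeasure_eq_map]
  convert! measurable_measure_prodMk_left (ν := Measure.infinitePi fun i : ℕ+ => gaussianReal 0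
        (if i ≤ I then K / (K + 1) * noiseVar p ε i else 0).toNNReal) (hmeas hs) using 2 with X
  exact Measure.map_apply (hmeas.comp measurable_prodMk_left) hs

lemma measurable_ddm (p ε K α : ℝ) : Measurable (ddm p ε K α) := by
  refine Measure.measurable_of_measurable_coe _ fun s hs => ?_
  simp only [ddm, Measure.sum_apply _ hs, Measure.smul_apply, smul_eq_mul]
  exact Measurable.tsum fun I => (measurable_weight p ε K α I).ennreal_ofReal.mul
    (Measure.measurable_coe hs |>.comp (measurable_componentMeasure p ε K I))

instance (p ε K : ℝ) (I : ℕ+) (X : ℕ+ → ℝ) : IsProbabilityMeasure (componentMeasure p ε K I X) := by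
  unfold componentMeasure; infer_instance

instance (p ε : ℝ) (θ : ℕ+ → ℝ) : IsProbabilityMeasure (dataLaw p ε θ) := by
  unfold dataLaw; infer_instance

lemma componentMeasure_ae_eq_zero (p ε K : ℝ) (I : ℕ+) (X : ℕ+ → ℝ) :
    ∀ᵐ ϑ ∂componentMeasure p ε K I X, ∀ i, I < i → ϑ i = 0 := by
  rw [ae_all_iff]
  intro i
  by_cases hi : I < i
  · have h := measurePreserving_eval_infinitePi (fun i : ℕ+ => gaussianReal (trunc I X i)
      (if i ≤ I then K / (K + 1) * noiseVar p ε i else 0).toNNReal) i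
    have h2 := h.quasiMeasurePreserving.ae (p := fun x : ℝ => x = 0) (by
      simp only [trunc, if_neg (not_le.mpr hi), Real.toNNReal_zero, gaussianReal_zero_var]
      exact (ae_dirac_iff (p := fun x : ℝ => x = 0) (measurableSet_singleton 0)).mpr rfl)
    filter_upwards [h2] with ϑ hϑ _ using hϑ
  · exact Eventually.of_forall fun ϑ h => absurd h hi

lemma ddm_ae_memℓp (p ε K α : ℝ) (X : ℕ+ → ℝ) : ∀ᵐ ϑ ∂ddm p ε K α X, Memℓp ϑ 2 := by
  rw [ddm, Measure.ae_sum_iff]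
  intro I
  refine Measure.ae_smul_measure ?_ _
  filter_upwards [componentMeasure_ae_eq_zero p ε K I X] with ϑ hϑ
  refine (memℓp_zero_iff.mpr ?_ : Memℓp ϑ 0).of_exponent_ge zero_le
  refine (Set.finite_Iic I).subset fun i hi => ?_
  by_contra h
  exact hi (hϑ i (not_le.mp h))

lemma isProbabilityMeasure_ddm {p ε K α : ℝ} {X : ℕ+ → ℝ}
    (h : ∑' I, ENNReal.ofReal (weight p ε K α I X) = 1) :
    IsProbabilityMeasure (ddm p ε K α X) := by
  constructor
  simp [ddm, Measure.sum_apply _ MeasurableSet.univ, h]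

/-! ### Gaussian moments -/

/-- Completing the square: the tilted density is a multiple of the normal density with mean
`m/(1-t)` and variance `v/(1-t)`. Negative `t` is allowed and is needed for models below the
reference. -/
lemma lintegral_exp_sq_gaussianReal {t v : ℝ} (ht : t < 1) (hv : 0 < v) (m : ℝ) :
    ∫⁻ x, ENNReal.ofReal (Real.exp (t * (x ^ 2 / (2 * v)))) ∂gaussianReal m v.toNNReal =
      ENNReal.ofReal ((√(1 - t))⁻¹ * Real.exp (t * m ^ 2 / (2 * v * (1 - t)))) := by
  have hv0 : v.toNNReal ≠ 0 := by simpa using hv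
  have h1t : 0 < 1 - t := by linarith
  have hw : 0 < v / (1 - t) := by positivity
  have hw0 : (v / (1 - t)).toNNReal ≠ 0 := by simpa using hw
  have key : ∀ x : ℝ, gaussianPDF m v.toNNReal x *
      ENNReal.ofReal (Real.exp (t * (x ^ 2 / (2 * v)))) =
      ENNReal.ofReal ((√(1 - t))⁻¹ * Real.exp (t * m ^ 2 / (2 * v * (1 - t)))) *
        gaussianPDF (m / (1 - t)) (v / (1 - t)).toNNReal x := by
    intro x
    simp only [gaussianPDF]
    rw [← ENNReal.ofReal_mul (gaussianPDFReal_nonneg _ _ _), ← ENNReal.ofReal_mul (by positivity)]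
    congr 1
    simp only [gaussianPDFReal_def, Real.coe_toNNReal _ hv.le, Real.coe_toNNReal _ hw.le]
    have h2 : √(2 * Real.pi * v) = √(1 - t) * √(2 * Real.pi * (v / (1 - t))) := by
      rw [← Real.sqrt_mul h1t.le]
      congr 1
      field_simp
    have h3 : Real.exp (-(x - m) ^ 2 / (2 * v)) * Real.exp (t * (x ^ 2 / (2 * v))) =
        Real.exp (t * m ^ 2 / (2 * v * (1 - t))) *
          Real.exp (-(x - m / (1 - t)) ^ 2 / (2 * (v / (1 - t)))) := by
      rw [← Real.exp_add, ← Real.exp_add]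
      congr 1
      field_simp
      ring
    rw [h2, mul_inv, mul_assoc, mul_assoc, h3]
    ring
  rw [gaussianReal_of_var_ne_zero _ hv0, lintegral_withDensity_eq_lintegral_mul _
    (measurable_gaussianPDF _ _) (by fun_prop)]
  simp only [Pi.mul_apply, key]
  rw [lintegral_const_mul _ (measurable_gaussianPDF _ _), lintegral_gaussianPDF_eq_one _ hw0, mul_one]

lemma inv_sqrt_one_sub_le {t : ℝ} (ht : t < 1) :
    (√(1 - t))⁻¹ ≤ Real.exp (t / (2 * (1 - t))) := by
  have h1t : 0 < 1 - t := by linarith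
  have h : (1 - t)⁻¹ ≤ Real.exp (t / (1 - t)) := by
    have := Real.add_one_le_exp (t / (1 - t))
    have h2 : t / (1 - t) + 1 = (1 - t)⁻¹ := by field_simp; ring
    linarith
  rw [← Real.sqrt_inv, Real.sqrt_le_left (Real.exp_pos _).le, ← Real.exp_nat_mul]
  refine h.trans (Real.exp_le_exp.mpr (le_of_eq ?_))
  push_cast
  field_simp

lemma lintegral_exp_sq_gaussianReal_le {t v : ℝ} (ht : t < 1) (hv : 0 < v) (m : ℝ) :
    ∫⁻ x, ENNReal.ofReal (Real.exp (t * (x ^ 2 / (2 * v)))) ∂gaussianReal m v.toNNReal ≤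
      ENNReal.ofReal (Real.exp (t / (2 * (1 - t)) * (1 + m ^ 2 / v))) := by
  rw [lintegral_exp_sq_gaussianReal ht hv]
  refine ENNReal.ofReal_le_ofReal ?_
  have h1t : 0 < 1 - t := by linarith
  rw [mul_add, mul_one, Real.exp_add]
  refine mul_le_mul (inv_sqrt_one_sub_le ht) (le_of_eq ?_) (Real.exp_pos _).le (Real.exp_pos _).le
  congr 1
  field_simp

lemma lintegral_sq_sub_gaussianReal (m a : ℝ) (v : NNReal) :
    ∫⁻ x, ENNReal.ofReal ((x - a) ^ 2) ∂gaussianReal m v ≤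
      ENNReal.ofReal (2 * v + 2 * (m - a) ^ 2) := by
  have h1 : Integrable (fun x : ℝ => (x - m) ^ 2) (gaussianReal m v) :=
    ((memLp_id_gaussianReal 2).sub (memLp_const m)).integrable_sq
  have h2 : ∫ x, (x - m) ^ 2 ∂gaussianReal m v = v := by
    have := variance_fun_id_gaussianReal (μ := m) (v := v)
    rwa [variance_eq_integral (by fun_prop), integral_id_gaussianReal] at this
  have h3 : ∫⁻ x, ENNReal.ofReal (2 * (x - m) ^ 2 + 2 * (m - a) ^ 2) ∂gaussianReal m v =
      ENNReal.ofReal (2 * v + 2 * (m - a) ^ 2) := by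
    have h4 : Integrable (fun x : ℝ => 2 * (x - m) ^ 2 + 2 * (m - a) ^ 2) (gaussianReal m v) :=
      (h1.const_mul 2).add (integrable_const _)
    rw [← ofReal_integral_eq_lintegral_ofReal h4 (Eventually.of_forall fun x => by positivity),
      integral_add (h1.const_mul 2) (integrable_const _), integral_const_mul, h2]
    simp
  rw [← h3]
  refine lintegral_mono fun x => ENNReal.ofReal_le_ofReal ?_
  nlinarith [sq_nonneg ((x - m) - (m - a))]

lemma lintegral_coord {p ε : ℝ} {θ : ℕ+ → ℝ} (i : ℕ+) {f : ℝ → ℝ≥0∞} (hf : Measurable f) :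
    ∫⁻ X, f (X i) ∂dataLaw p ε θ = ∫⁻ x, f x ∂gaussianReal (θ i) (noiseVar p ε i).toNNReal :=
  (measurePreserving_eval_infinitePi
    (fun i => gaussianReal (θ i) (noiseVar p ε i).toNNReal) i).lintegral_comp hf

lemma lintegral_noise_pow_four_le {p ε : ℝ} (hε : 0 < ε) (θ : ℕ+ → ℝ) (i : ℕ+) :
    ∫⁻ X, ENNReal.ofReal (((X i - θ i) ^ 2 / noiseVar p ε i) ^ 2) ∂dataLaw p ε θ ≤
      ENNReal.ofReal 64 := by
  have hv := noiseVar_pos (p := p) hε i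
  set v := noiseVar p ε i with hvdef
  rw [lintegral_coord i (f := fun x => ENNReal.ofReal (((x - θ i) ^ 2 / v) ^ 2)) (by fun_prop),
    ← hvdef]
  have hmap : gaussianReal 0 v.toNNReal = (gaussianReal (θ i) v.toNNReal).map (fun x => x - θ i) := by
    rw [gaussianReal_map_sub_const, sub_self]
  have h1 : ∫⁻ x, ENNReal.ofReal (((x - θ i) ^ 2 / v) ^ 2) ∂gaussianReal (θ i) v.toNNReal =
      ∫⁻ x, ENNReal.ofReal ((x ^ 2 / v) ^ 2) ∂gaussianReal 0 v.toNNReal := by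
    rw [hmap, lintegral_map (f := fun x : ℝ => ENNReal.ofReal ((x ^ 2 / v) ^ 2)) (by fun_prop)
      (by fun_prop)]
  rw [h1]
  calc ∫⁻ x, ENNReal.ofReal ((x ^ 2 / v) ^ 2) ∂gaussianReal 0 v.toNNReal
      ≤ ∫⁻ x, ENNReal.ofReal 32 * ENNReal.ofReal (Real.exp (1 / 2 * (x ^ 2 / (2 * v))))
          ∂gaussianReal 0 v.toNNReal := by
        refine lintegral_mono fun x => ?_
        rw [← ENNReal.ofReal_mul (by norm_num)]
        refine ENNReal.ofReal_le_ofReal ?_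
        -- With `y = x²/v`, the bound `z²/2 ≤ exp z` at `z = y/4` gives `y² ≤ 32 exp (y/4)`; the
        -- remaining expectation is at most `exp (1/2) ≤ 2`, whence 64.
        have h := Real.quadratic_le_exp_of_nonneg (x := 1 / 2 * (x ^ 2 / (2 * v))) (by positivity)
        have h2 : 1 / 2 * (x ^ 2 / (2 * v)) = (x ^ 2 / v) / 4 := by ring
        have h3 : 0 ≤ x ^ 2 / v := by positivity
        rw [h2] at h ⊢
        nlinarith
    _ ≤ ENNReal.ofReal 32 * ENNReal.ofReal (Real.exp (1 / 2)) := by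
        rw [lintegral_const_mul _ (by fun_prop)]
        gcongr
        refine (lintegral_exp_sq_gaussianReal_le (by norm_num) hv 0).trans ?_
        norm_num
    _ ≤ ENNReal.ofReal 64 := by
        rw [← ENNReal.ofReal_mul (by norm_num)]
        refine ENNReal.ofReal_le_ofReal ?_
        have : Real.exp (1 / 2) ≤ 2 := by
          rw [← Real.le_log_iff_exp_le (by norm_num)]
          linarith [Real.log_two_gt_d9]
        linarith

/-! ### Expected powers of posterior odds -/

lemma measurable_logFactor (p ε K : ℝ) (i : ℕ+) :
    Measurable fun X => logFactor p ε K X i := by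
  unfold logFactor; fun_prop

lemma measurable_logWeight (p ε K α : ℝ) (I : ℕ+) :
    Measurable fun X => logWeight p ε K α X I := by
  unfold logWeight
  exact (Finset.measurable_fun_sum _ fun i _ => measurable_logFactor p ε K i).const_add _

lemma lintegral_exp_sum_logFactor_le {p ε K t : ℝ} (hε : 0 < ε) (ht : t < 1) (θ : ℕ+ → ℝ)
    (F : Finset ℕ+) :
    ∫⁻ X, ENNReal.ofReal (Real.exp (t * ∑ i ∈ F, logFactor p ε K X i)) ∂dataLaw p ε θ ≤
      ENNReal.ofReal (Real.exp (∑ i ∈ F, (t / (2 * (1 - t)) * (1 + θ i ^ 2 / noiseVar p ε i) -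
        t * (Real.log (K + 1) / 2)))) := by
  set f : ℕ+ → ℝ → ℝ≥0∞ := fun i x => ENNReal.ofReal
    (Real.exp (t * (x ^ 2 / (2 * noiseVar p ε i) - Real.log (K + 1) / 2))) with hf
  have hfm : ∀ i, Measurable (f i) := fun i => by simp only [hf]; fun_prop
  have hprod : ∀ X : ℕ+ → ℝ, ENNReal.ofReal (Real.exp (t * ∑ i ∈ F, logFactor p ε K X i)) =
      ∏ i ∈ F, f i (X i) := by
    intro X
    simp only [hf]
    rw [← ENNReal.ofReal_prod_of_nonneg (fun _ _ => (Real.exp_pos _).le), ← Real.exp_sum,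
      Finset.mul_sum]
    rfl
  simp only [hprod]
  have hind : iIndepFun (fun (i : ℕ+) (X : ℕ+ → ℝ) => f i (X i)) (dataLaw p ε θ) :=
    iIndepFun_infinitePi hfm
  rw [lintegral_prod_eq_prod_lintegral_of_indepFun F _ hind
    (fun i => (hfm i).comp (measurable_pi_apply i)), Real.exp_sum,
    ENNReal.ofReal_prod_of_nonneg (fun _ _ => (Real.exp_pos _).le)]
  refine Finset.prod_le_prod' fun i _ => ?_
  rw [lintegral_coord i (hfm i)]
  have hsplit : ∀ x, f i x = ENNReal.ofReal (Real.exp (t * (x ^ 2 / (2 * noiseVar p ε i)))) *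
      ENNReal.ofReal (Real.exp (-(t * (Real.log (K + 1) / 2)))) := by
    intro x
    rw [← ENNReal.ofReal_mul (Real.exp_pos _).le, ← Real.exp_add]
    simp only [hf]
    congr 2
    ring
  simp only [hsplit]
  rw [lintegral_mul_const _ (by fun_prop), sub_eq_add_neg, Real.exp_add,
    ENNReal.ofReal_mul (Real.exp_pos _).le]
  gcongr
  exact lintegral_exp_sq_gaussianReal_le ht (noiseVar_pos hε i) (θ i)

lemma sum_Iic_eq_add_Ioc {M : Type*} [AddCommMonoid M] (f : ℕ+ → M) {a b : ℕ+} (h : a ≤ b) :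
    ∑ i ∈ Finset.Iic b, f i = ∑ i ∈ Finset.Iic a, f i + ∑ i ∈ Finset.Ioc a b, f i := by
  rw [← Finset.sum_union]
  · congr 1
    ext i
    simp only [Finset.mem_Iic, Finset.mem_union, Finset.mem_Ioc]
    constructor
    · intro hi
      rcases le_or_gt i a with h' | h'
      · exact Or.inl h'
      · exact Or.inr ⟨h', hi⟩
    · rintro (h' | h')
      · exact h'.trans h
      · exact h'.2
  · rw [Finset.disjoint_left]
    intro i hi hi'
    simp only [Finset.mem_Iic, Finset.mem_Ioc] at hi hi'
    exact absurd hi'.1 (not_lt.mpr hi)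

lemma logWeight_sub (p ε K α : ℝ) (X : ℕ+ → ℝ) {a b : ℕ+} (h : a ≤ b) :
    logWeight p ε K α X b - logWeight p ε K α X a =
      -α * ((b : ℝ) - a) + ∑ i ∈ Finset.Ioc a b, logFactor p ε K X i := by
  rw [logWeight, logWeight, sum_Iic_eq_add_Ioc _ h]
  ring

lemma card_Ioc_cast {a b : ℕ+} (h : a ≤ b) : ((Finset.Ioc a b).card : ℝ) = (b : ℝ) - a := by
  rw [PNat.card_Ioc, Nat.cast_sub (by exact_mod_cast h)]

/-- Expected fractional power of the posterior odds of a larger model. -/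
lemma lintegral_odds_larger_le {p ε K α t : ℝ} (hε : 0 < ε) (ht : t < 1) (θ : ℕ+ → ℝ)
    {a b : ℕ+} (h : a ≤ b) :
    ∫⁻ X, ENNReal.ofReal (Real.exp (t * (logWeight p ε K α X b - logWeight p ε K α X a)))
        ∂dataLaw p ε θ ≤
      ENNReal.ofReal (Real.exp (-(t * (α + Real.log (K + 1) / 2)) * ((b : ℝ) - a) +
        t / (2 * (1 - t)) *
          (((b : ℝ) - a) + ∑ i ∈ Finset.Ioc a b, θ i ^ 2 / noiseVar p ε i))) := by
  have hsplit : ∀ X, ENNReal.ofReal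
      (Real.exp (t * (logWeight p ε K α X b - logWeight p ε K α X a))) =
      ENNReal.ofReal (Real.exp (-(t * α) * ((b : ℝ) - a))) * ENNReal.ofReal
        (Real.exp (t * ∑ i ∈ Finset.Ioc a b, logFactor p ε K X i)) := by
    intro X
    rw [logWeight_sub _ _ _ _ _ h, ← ENNReal.ofReal_mul (Real.exp_pos _).le, ← Real.exp_add]
    congr 2
    ring
  simp only [hsplit]
  rw [lintegral_const_mul' _ _ ENNReal.ofReal_ne_top]
  refine (mul_le_mul_right (lintegral_exp_sum_logFactor_le hε ht θ _) _).trans (le_of_eq ?_)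
  rw [← ENNReal.ofReal_mul (Real.exp_pos _).le, ← Real.exp_add, Finset.sum_sub_distrib,
    ← Finset.mul_sum, Finset.sum_add_distrib]
  simp only [Finset.sum_const, nsmul_eq_mul, card_Ioc_cast h]
  congr 2
  ring

/-! ### Growth of the noise variances and summation by parts -/

lemma noiseVar_mono {p ε : ℝ} (hp : 0 ≤ p) : Monotone (noiseVar p ε) := by
  intro i j hij
  have h : (i : ℝ) ≤ j := by exact_mod_cast hij
  unfold noiseVar
  gcongr

lemma sum_Iic_succ {M : Type*} [AddCommMonoid M] (f : ℕ+ → M) (n : ℕ+) :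
    ∑ i ∈ Finset.Iic (n + 1), f i = ∑ i ∈ Finset.Iic n, f i + f (n + 1) := by
  have h : Finset.Ioc n (n + 1) = {n + 1} := by
    ext i
    simp only [Finset.mem_Ioc, Finset.mem_singleton, ← PNat.coe_lt_coe, ← PNat.coe_le_coe,
      ← PNat.coe_inj, PNat.add_coe, PNat.one_coe]
    omega
  rw [sum_Iic_eq_add_Ioc f (PNat.lt_add_right n 1).le, h, Finset.sum_singleton]

lemma mul_noiseVar_le_sum {p ε : ℝ} (hp : 0 ≤ p) (n : ℕ+) :
    (n : ℝ) * noiseVar p ε n ≤ (2 * p + 1) * ∑ i ∈ Finset.Iic n, noiseVar p ε i := by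
  have hmul : ∀ n : ℕ+, (n : ℝ) * noiseVar p ε n = ε ^ 2 * (n : ℝ) ^ (2 * p + 1) := by
    intro n
    have : (0 : ℝ) < n := by exact_mod_cast n.pos
    rw [noiseVar, Real.rpow_add_one this.ne']
    ring
  induction n using PNat.recOn with
  | one =>
    have h : Finset.Iic (1 : ℕ+) = {1} := by
      ext i
      simp
    rw [h, Finset.sum_singleton]
    have : (0 : ℝ) ≤ noiseVar p ε 1 := by unfold noiseVar; positivity
    push_cast
    nlinarith
  | succ n ih =>
    have hn : (0 : ℝ) < n := by exact_mod_cast n.pos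
    rw [hmul] at ih ⊢
    rw [sum_Iic_succ, mul_add]
    refine le_trans ?_ (add_le_add_left ih _)
    have hcast : ((n + 1 : ℕ+) : ℝ) = (n : ℝ) + 1 := by push_cast; rfl
    -- Bernoulli's inequality bounds the increment of `n ^ (2p+1)` by `(2p+1)` times the new
    -- variance (up to `ε²`).
    have hb := one_add_mul_self_le_rpow_one_add (s := -(1 / ((n : ℝ) + 1)))
      (by rw [neg_le_neg_iff, div_le_one (by positivity)]; linarith)
      (show (1 : ℝ) ≤ 2 * p + 1 by linarith)
    have hfrac : 1 + -(1 / ((n : ℝ) + 1)) = n / (n + 1) := by field_simp; ring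
    rw [hfrac, Real.div_rpow hn.le (by positivity)] at hb
    have hpow : (0 : ℝ) < ((n : ℝ) + 1) ^ (2 * p + 1) := by positivity
    rw [le_div_iff₀ hpow] at hb
    rw [noiseVar, hcast]
    have hsplit : ((n : ℝ) + 1) ^ (2 * p + 1) = ((n : ℝ) + 1) ^ (2 * p) * (n + 1) :=
      Real.rpow_add_one (by positivity) _
    have hexp : (1 + (2 * p + 1) * -(1 / ((n : ℝ) + 1))) * ((n : ℝ) + 1) ^ (2 * p + 1) =
        ((n : ℝ) + 1) ^ (2 * p + 1) - (2 * p + 1) * ((n : ℝ) + 1) ^ (2 * p) := by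
      rw [hsplit]; field_simp; ring
    rw [hexp] at hb
    have := mul_le_mul_of_nonneg_left hb (sq_nonneg ε)
    linarith

/-- The growth factor is polynomial in `b - a` and uniform in `a` and `ε`, so exponential decay of
the weights dominates it with a constant free of the reference model. It rests on `b ≤ (1 + (b - a))
a`, valid as `a ≥ 1`. -/
lemma sum_noiseVar_le {p ε : ℝ} (hp : 0 ≤ p) {a b : ℕ+} (h : a ≤ b) :
    ∑ i ∈ Finset.Iic b, noiseVar p ε i ≤
      (1 + ((b : ℝ) - a)) ^ (2 * p + 1) * ∑ i ∈ Finset.Iic a, noiseVar p ε i := by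
  have ha : (1 : ℝ) ≤ a := by exact_mod_cast one_le
  have hd : (0 : ℝ) ≤ (b : ℝ) - a := sub_nonneg.mpr (by exact_mod_cast h)
  have hnn : ∀ i : ℕ+, 0 ≤ noiseVar p ε i := fun i => by unfold noiseVar; positivity
  have hone : (1 : ℝ) ≤ (1 + ((b : ℝ) - a)) ^ (2 * p) :=
    Real.one_le_rpow (by linarith) (by linarith)
  have hterm : ∀ i ∈ Finset.Ioc a b, noiseVar p ε i ≤
      (1 + ((b : ℝ) - a)) ^ (2 * p) * ∑ j ∈ Finset.Iic a, noiseVar p ε j := by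
    intro i hi
    have hib : (i : ℝ) ≤ b := by exact_mod_cast (Finset.mem_Ioc.mp hi).2
    have h1 : (i : ℝ) ≤ (1 + ((b : ℝ) - a)) * a := by nlinarith
    calc noiseVar p ε i ≤ ε ^ 2 * ((1 + ((b : ℝ) - a)) * a) ^ (2 * p) := by
          unfold noiseVar; gcongr
      _ = (1 + ((b : ℝ) - a)) ^ (2 * p) * noiseVar p ε a := by
          rw [Real.mul_rpow (by linarith) (by linarith), noiseVar]; ring
      _ ≤ _ := by
          gcongr
          exact Finset.single_le_sum (f := noiseVar p ε) (fun i _ => hnn i)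
            (Finset.mem_Iic.mpr le_rfl)
  have hS : 0 ≤ ∑ j ∈ Finset.Iic a, noiseVar p ε j := Finset.sum_nonneg fun i _ => hnn i
  rw [sum_Iic_eq_add_Ioc _ h, Real.rpow_add_one (by linarith)]
  have h2 := Finset.sum_le_sum hterm
  rw [Finset.sum_const, nsmul_eq_mul, card_Ioc_cast h] at h2
  nlinarith [mul_le_mul_of_nonneg_right hone hS]

/-- Summation by parts: dominated partial sums stay dominated after division by a monotone
positive sequence. -/
lemma sum_div_le_card {u v : ℕ+ → ℝ} (hv : ∀ i, 0 < v i) (hmono : Monotone v) {a b : ℕ+}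
    (hab : a ≤ b) (h : ∀ c, a ≤ c → ∑ i ∈ Finset.Ioc a c, u i ≤ ∑ i ∈ Finset.Ioc a c, v i) :
    ∑ i ∈ Finset.Ioc a b, u i / v i ≤ (b : ℝ) - a := by
  -- The induction needs this stronger form: the accumulated slack is nonnegative, so dividing it by
  -- the next, larger `v` only decreases it.
  have key : ∀ k : ℕ, ∀ b : ℕ+, (b : ℕ) = a + k →
      (∑ i ∈ Finset.Ioc a b, (v i - u i)) / v b ≤ ∑ i ∈ Finset.Ioc a b, (1 - u i / v i) := by
    intro k
    induction k with
    | zero =>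
      intro b hb
      obtain rfl : b = a := PNat.coe_injective (by simpa using hb)
      simp
    | succ k ih =>
      intro b hb
      obtain ⟨c, rfl⟩ : ∃ c : ℕ+, b = c + 1 := PNat.exists_eq_succ_of_ne_one (by
        rintro rfl
        have := a.pos
        simp only [PNat.one_coe] at hb
        omega)
      have hc : (c : ℕ) = a + k := by simpa [← add_assoc] using hb
      have hac : a ≤ c := by rw [← PNat.coe_le_coe]; omega
      have hIoc : Finset.Ioc a (c + 1) = insert (c + 1) (Finset.Ioc a c) := by
        ext i
        simp only [Finset.mem_Ioc, Finset.mem_insert, ← PNat.coe_lt_coe, ← PNat.coe_le_coe,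
          ← PNat.coe_inj, PNat.add_coe, PNat.one_coe]
        omega
      have hnot : c + 1 ∉ Finset.Ioc a c := by
        simp only [Finset.mem_Ioc, ← PNat.coe_le_coe, PNat.add_coe, PNat.one_coe]
        omega
      rw [hIoc, Finset.sum_insert hnot, Finset.sum_insert hnot, add_div, sub_div,
        div_self (hv _).ne']
      refine add_le_add_right (le_trans ?_ (ih c hc)) _
      refine div_le_div_of_nonneg_left ?_ (hv c) (hmono (PNat.lt_add_right c 1).le)
      rw [Finset.sum_sub_distrib]
      exact sub_nonneg.mpr (h c hac)
  have h1 := key ((b : ℕ) - a) b (by have : (a : ℕ) ≤ b := hab; omega)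
  rw [Finset.sum_sub_distrib, Finset.sum_sub_distrib, Finset.sum_const, nsmul_eq_mul,
    card_Ioc_cast hab, mul_one] at h1
  have h2 := div_nonneg (sub_nonneg.mpr (h b hab)) (hv b).le
  linarith

/-! ### The oracle and the reference model -/

lemma summable_sq (θ : EllTwo) : Summable fun i => θ i ^ 2 := by
  have := (lp.memℓp θ).summable (by norm_num)
  simpa using this

lemma tail_eq_add (θ : EllTwo) {a b : ℕ+} (h : a ≤ b) :
    ∑' i : Set.Ioi a, θ i ^ 2 = ∑ i ∈ Finset.Ioc a b, θ i ^ 2 + ∑' i : Set.Ioi b, θ i ^ 2 := by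
  have htot : ∀ a : ℕ+, ∑ i ∈ Finset.Iic a, θ i ^ 2 + ∑' i : Set.Ioi a, θ i ^ 2 =
      ∑' i, θ i ^ 2 := by
    intro a
    have := (summable_sq θ).sum_add_tsum_compl (s := Finset.Iic a)
    rwa [Finset.coe_Iic, Set.compl_Iic] at this
  have h1 := htot a
  have h2 := htot b
  rw [sum_Iic_eq_add_Ioc _ h] at h2
  linarith

lemma rateSq_nonneg {p ε : ℝ} (θ : EllTwo) (I : ℕ+) : 0 ≤ rateSq p ε θ I := by
  refine add_nonneg (Finset.sum_nonneg fun i _ => ?_) (tsum_nonneg fun i => sq_nonneg _)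
  unfold noiseVar; positivity

lemma tendsto_sum_noiseVar {p ε : ℝ} (hp : 0 ≤ p) (hε : 0 < ε) :
    Tendsto (fun I : ℕ+ => ∑ i ∈ Finset.Iic I, noiseVar p ε i) cofinite atTop := by
  have hle : ∀ I : ℕ+, ε ^ 2 * (I : ℝ) ≤ ∑ i ∈ Finset.Iic I, noiseVar p ε i := by
    intro I
    have h : ∀ i ∈ Finset.Iic I, ε ^ 2 ≤ noiseVar p ε i := by
      intro i _
      have hi : (1 : ℝ) ≤ i := by exact_mod_cast one_le
      have := Real.one_le_rpow hi (show 0 ≤ 2 * p by linarith)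
      unfold noiseVar
      nlinarith [sq_nonneg ε]
    have := Finset.card_nsmul_le_sum _ _ _ h
    have hc : (Finset.Iic I).card = I := by
      have h1 : Finset.Iic I = Finset.Icc 1 I := by ext i; simp
      rw [h1, PNat.card_Icc]
      simp
    rw [hc, nsmul_eq_mul] at this
    linarith
  refine tendsto_atTop_mono hle (Tendsto.const_mul_atTop (by positivity) ?_)
  refine tendsto_natCast_atTop_atTop.comp ?_
  rw [← Nat.cofinite_eq_atTop]
  exact PNat.coe_injective.tendsto_cofinite

/-- A reference model: it minimizes the risk with the bias inflated by `A`. -/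
lemma exists_reference {p ε A : ℝ} (hp : 0 ≤ p) (hε : 0 < ε) (hA : 1 ≤ A) (θ : EllTwo) :
    ∃ I₀ : ℕ+, (∀ I, I₀ ≤ I → ∑ i ∈ Finset.Ioc I₀ I, A * θ i ^ 2 ≤
        ∑ i ∈ Finset.Ioc I₀ I, noiseVar p ε i) ∧
      rateSq p ε θ I₀ ≤ A * oracleRate p ε θ ^ 2 := by
  have htail : ∀ I : ℕ+, 0 ≤ ∑' i : Set.Ioi I, θ i ^ 2 := fun I => tsum_nonneg fun i => sq_nonneg _
  have hsum : ∀ I : ℕ+, 0 ≤ ∑ i ∈ Finset.Iic I, noiseVar p ε i := fun I =>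
    Finset.sum_nonneg fun i _ => (noiseVar_pos hε i).le
  obtain ⟨I₀, hI₀⟩ := Tendsto.exists_forall_le
    (f := fun I : ℕ+ => ∑ i ∈ Finset.Iic I, noiseVar p ε i + A * ∑' i : Set.Ioi I, θ i ^ 2)
    (tendsto_atTop_mono (fun I => le_add_of_nonneg_right (by have := htail I; positivity))
      (tendsto_sum_noiseVar hp hε))
  refine ⟨I₀, fun I hI => ?_, ?_⟩
  · have := hI₀ I
    rw [sum_Iic_eq_add_Ioc _ hI, tail_eq_add θ hI] at this
    rw [← Finset.mul_sum]
    linarith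
  · have hbdd : ∀ I, rateSq p ε θ I₀ / A ≤ rateSq p ε θ I := by
      intro I
      rw [div_le_iff₀ (by linarith)]
      have := hI₀ I
      unfold rateSq
      nlinarith [htail I₀, hsum I]
    rw [oracleRate, Real.sq_sqrt (Real.iInf_nonneg fun I => rateSq_nonneg θ I), mul_comm,
      ← div_le_iff₀ (by linarith)]
    exact le_ciInf hbdd

lemma oracleRate_pos {p ε : ℝ} (hε : 0 < ε) (θ : EllTwo) : 0 < oracleRate p ε θ := by
  refine Real.sqrt_pos.mpr (lt_of_lt_of_le (noiseVar_pos (p := p) hε 1) (le_ciInf fun I => ?_))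
  refine le_trans ?_ (le_add_of_nonneg_right (tsum_nonneg fun i => sq_nonneg _))
  exact Finset.single_le_sum (f := noiseVar p ε) (fun i _ => (noiseVar_pos hε i).le)
    (Finset.mem_Iic.mpr one_le)

/-! ### Odds against the reference model -/

/-- Per extra coordinate the exponent is at most `-h(α + log (K+1)/2) + h/2 + 2h²`. The assumption
on `K` removes the terms of order `h` without `α`, and `4h ≤ α` absorbs `2h²` into half of `hα`. -/
lemma lintegral_odds_larger_reference_le {p ε K α h : ℝ} (hp : 0 ≤ p) (hε : 0 < ε)
    (hK : 1 ≤ Real.log (K + 1)) (h0 : 0 < h) (h1 : h ≤ 1 / 2) (hα : 4 * h ≤ α) {θ : ℕ+ → ℝ}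
    {I₀ : ℕ+} (hdom : ∀ I, I₀ ≤ I → ∑ i ∈ Finset.Ioc I₀ I, h⁻¹ * θ i ^ 2 ≤
      ∑ i ∈ Finset.Ioc I₀ I, noiseVar p ε i) {I : ℕ+} (hI : I₀ ≤ I) :
    ∫⁻ X, ENNReal.ofReal (Real.exp (h * (logWeight p ε K α X I - logWeight p ε K α X I₀)))
        ∂dataLaw p ε θ ≤
      ENNReal.ofReal (Real.exp (-(h * α / 2) * ((I : ℝ) - I₀))) := by
  refine (lintegral_odds_larger_le hε (by linarith) θ hI).trans
    (ENNReal.ofReal_le_ofReal (Real.exp_le_exp.mpr ?_))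
  have hd : (0 : ℝ) ≤ (I : ℝ) - I₀ := sub_nonneg.mpr (by exact_mod_cast hI)
  set d : ℝ := (I : ℝ) - I₀
  have hs : ∑ i ∈ Finset.Ioc I₀ I, θ i ^ 2 / noiseVar p ε i ≤ h * d := by
    have := sum_div_le_card (fun i => noiseVar_pos hε i) (noiseVar_mono hp) hI hdom
    simp only [mul_div_assoc] at this
    rw [← Finset.mul_sum, inv_mul_le_iff₀ h0] at this
    exact this
  have hcoef : h / (2 * (1 - h)) ≤ h := by
    rw [div_le_iff₀ (by linarith)]
    nlinarith
  have hcoef2 : h / (2 * (1 - h)) ≤ h / 2 + h * h := by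
    rw [div_le_iff₀ (by linarith)]
    nlinarith [mul_nonneg (mul_nonneg h0.le h0.le) (show 0 ≤ 1 - 2 * h by linarith)]
  have hcoef0 : 0 ≤ h / (2 * (1 - h)) := div_nonneg h0.le (by linarith)
  have hb1 : h / (2 * (1 - h)) * (d + ∑ i ∈ Finset.Ioc I₀ I, θ i ^ 2 / noiseVar p ε i) ≤
      (h / 2 + h * h) * d + h * (h * d) := by
    rw [mul_add]
    exact add_le_add (mul_le_mul_of_nonneg_right hcoef2 hd)
      ((mul_le_mul_of_nonneg_left hs hcoef0).trans
        (mul_le_mul_of_nonneg_right hcoef (by positivity)))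
  have h2 : 0 ≤ h * d * (α - 4 * h) := mul_nonneg (mul_nonneg h0.le hd) (by linarith)
  have h3 : 0 ≤ h * d * (Real.log (K + 1) - 1) := mul_nonneg (mul_nonneg h0.le hd) (by linarith)
  nlinarith

/-- This is the power `t = -1` of the odds of the larger model, where `t/(2(1-t)) = -1/4`. By
monotonicity every variance may be replaced by the largest, at `I₀`. -/
lemma lintegral_odds_smaller_le {p ε K α : ℝ} (hp : 0 ≤ p) (hε : 0 < ε) (θ : ℕ+ → ℝ)
    {I I₀ : ℕ+} (hI : I ≤ I₀) :
    ∫⁻ X, ENNReal.ofReal (Real.exp (1 * (logWeight p ε K α X I - logWeight p ε K α X I₀)))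
        ∂dataLaw p ε θ ≤
      ENNReal.ofReal (Real.exp ((α + Real.log (K + 1) / 2) * ((I₀ : ℝ) - I) -
        (∑ i ∈ Finset.Ioc I I₀, θ i ^ 2) / (4 * noiseVar p ε I₀))) := by
  have hflip : ∀ X, 1 * (logWeight p ε K α X I - logWeight p ε K α X I₀) =
      -1 * (logWeight p ε K α X I₀ - logWeight p ε K α X I) := fun X => by ring
  simp only [hflip]
  refine (lintegral_odds_larger_le hε (by norm_num) θ hI).trans
    (ENNReal.ofReal_le_ofReal (Real.exp_le_exp.mpr ?_))
  have hd : (0 : ℝ) ≤ (I₀ : ℝ) - I := sub_nonneg.mpr (by exact_mod_cast hI)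
  have hs : (∑ i ∈ Finset.Ioc I I₀, θ i ^ 2) / noiseVar p ε I₀ ≤
      ∑ i ∈ Finset.Ioc I I₀, θ i ^ 2 / noiseVar p ε i := by
    rw [Finset.sum_div]
    refine Finset.sum_le_sum fun i hi => ?_
    exact div_le_div_of_nonneg_left (sq_nonneg _) (noiseVar_pos hε i)
      (noiseVar_mono hp (Finset.mem_Ioc.mp hi).2)
  have h4 : (∑ i ∈ Finset.Ioc I I₀, θ i ^ 2) / (4 * noiseVar p ε I₀) =
      (∑ i ∈ Finset.Ioc I I₀, θ i ^ 2) / noiseVar p ε I₀ / 4 := by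
    rw [mul_comm, div_div]
  rw [h4]
  norm_num
  linarith

lemma natCast_sub_of_mem {I₀ : ℕ+} (I : Set.Ioi I₀) :
    ((((I : ℕ+) : ℕ) - (I₀ : ℕ) : ℕ) : ℝ) = ((I : ℕ+) : ℝ) - I₀ :=
  Nat.cast_sub (by exact_mod_cast I.2.le)

lemma tsum_Ioi_le (g : ℕ → ℝ≥0∞) (I₀ : ℕ+) :
    ∑' I : Set.Ioi I₀, g (((I : ℕ+) : ℕ) - (I₀ : ℕ)) ≤ ∑' d, g d := by
  refine ENNReal.tsum_comp_le_tsum_of_injective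
    (f := fun I : Set.Ioi I₀ => ((I : ℕ+) : ℕ) - (I₀ : ℕ)) ?_ g
  rintro ⟨a, ha⟩ ⟨b, hb⟩ hab
  have ha' : (I₀ : ℕ) < a := ha
  have hb' : (I₀ : ℕ) < b := hb
  simp only at hab
  exact Subtype.ext (PNat.coe_injective (by simp only; omega))

lemma summable_rpow_mul_exp {c : ℝ} (hc : 0 < c) (q : ℝ) :
    Summable fun d : ℕ => Real.exp (-c * d) * (1 + (d : ℝ)) ^ q := by
  have h := (summable_nat_add_iff 1).mpr (Real.summable_pow_mul_exp_neg_nat_mul ⌈q⌉₊ hc)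
  refine Summable.of_nonneg_of_le (fun d => by positivity) (fun d => ?_) (h.mul_left (Real.exp c))
  have h1 : (1 + (d : ℝ)) ^ q ≤ (1 + (d : ℝ)) ^ ⌈q⌉₊ := by
    rw [← Real.rpow_natCast]
    exact Real.rpow_le_rpow_of_exponent_le (by linarith [d.cast_nonneg (α := ℝ)]) (Nat.le_ceil q)
  have h2 : Real.exp c * Real.exp (-c * ((d + 1 : ℕ) : ℝ)) = Real.exp (-c * d) := by
    rw [← Real.exp_add]
    congr 1
    push_cast
    ring
  calc Real.exp (-c * d) * (1 + (d : ℝ)) ^ q ≤ Real.exp (-c * d) * (1 + (d : ℝ)) ^ ⌈q⌉₊ := by gcongr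
    _ = Real.exp c * (((d + 1 : ℕ) : ℝ) ^ ⌈q⌉₊ * Real.exp (-c * ((d + 1 : ℕ) : ℝ))) := by
      rw [← h2]
      push_cast
      ring

lemma ae_summable_exp_logWeight {p ε K α h : ℝ} (hp : 0 ≤ p) (hε : 0 < ε)
    (hK : 1 ≤ Real.log (K + 1)) (h0 : 0 < h) (h1 : h ≤ 1 / 2) (hα : 4 * h ≤ α) {θ : ℕ+ → ℝ}
    {I₀ : ℕ+} (hdom : ∀ I, I₀ ≤ I → ∑ i ∈ Finset.Ioc I₀ I, h⁻¹ * θ i ^ 2 ≤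
      ∑ i ∈ Finset.Ioc I₀ I, noiseVar p ε i) :
    ∀ᵐ X ∂dataLaw p ε θ, Summable fun J => Real.exp (logWeight p ε K α X J) := by
  have hmeas : ∀ I : Set.Ioi I₀, Measurable fun X : ℕ+ → ℝ => ENNReal.ofReal
      (Real.exp (h * (logWeight p ε K α X I - logWeight p ε K α X I₀))) := by
    intro I
    have ha := measurable_logWeight p ε K α (I : ℕ+)
    have hb := measurable_logWeight p ε K α I₀
    fun_prop
  have hc : 0 < h * α / 2 := by nlinarith
  have hfin : ∫⁻ X, ∑' I : Set.Ioi I₀, ENNReal.ofReal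
      (Real.exp (h * (logWeight p ε K α X I - logWeight p ε K α X I₀))) ∂dataLaw p ε θ ≠ ∞ := by
    rw [lintegral_tsum fun I => (hmeas I).aemeasurable]
    refine ne_top_of_le_ne_top ?_ (ENNReal.tsum_le_tsum fun I : Set.Ioi I₀ =>
      lintegral_odds_larger_reference_le hp hε hK h0 h1 hα hdom I.2.le)
    have hg := summable_rpow_mul_exp hc 0
    simp only [Real.rpow_zero, mul_one] at hg
    refine ne_top_of_le_ne_top ?_ ((le_of_eq (tsum_congr fun I => ?_)).trans
      (tsum_Ioi_le (fun d => ENNReal.ofReal (Real.exp (-(h * α / 2) * d))) I₀))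
    · rw [← ENNReal.ofReal_tsum_of_nonneg (fun _ => (Real.exp_pos _).le) hg]
      exact ENNReal.ofReal_ne_top
    · rw [natCast_sub_of_mem]
  filter_upwards [ae_lt_top (Measurable.tsum hmeas) hfin] with X hX
  have hs := ENNReal.summable_toReal hX.ne
  simp only [ENNReal.toReal_ofReal (Real.exp_pos _).le] at hs
  have hs' : Summable fun I : ℕ+ =>
      Real.exp (h * (logWeight p ε K α X I - logWeight p ε K α X I₀)) := by
    rw [← (Finset.Iic I₀).summable_compl_iff]
    refine hs.comp_injective (i := fun x : {x // x ∉ Finset.Iic I₀} =>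
      (⟨x, by simpa using x.2⟩ : Set.Ioi I₀)) fun x y hxy => ?_
    exact Subtype.ext (by simpa using hxy)
  -- Summable `h`-th powers are eventually at most 1, and there the odds lie below their `h`-th
  -- power.
  have hs2 : Summable fun I : ℕ+ =>
      Real.exp (logWeight p ε K α X I - logWeight p ε K α X I₀) := by
    refine Summable.of_norm_bounded_eventually hs' ?_
    filter_upwards [hs'.tendsto_cofinite_zero.eventually_le_const one_pos] with I hI
    rw [Real.norm_eq_abs, abs_of_pos (Real.exp_pos _)]
    refine Real.exp_le_exp.mpr ?_
    have : logWeight p ε K α X I - logWeight p ε K α X I₀ ≤ 0 := by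
      rw [Real.exp_le_one_iff] at hI
      by_contra hcon
      exact absurd hI (not_le.mpr (mul_pos h0 (not_le.mp hcon)))
    nlinarith
  have := hs2.mul_right (Real.exp (logWeight p ε K α X I₀))
  simpa [← Real.exp_add] using this

/-! ### Posterior risk: noise and bias -/

/-- Mean squared distance to `θ` under a single component, bounded by noise and bias. -/
lemma lintegral_componentMeasure_sq_le {p ε K : ℝ} (hK : 0 < K) (hε : 0 < ε) (θ : EllTwo)
    (I : ℕ+) (X : ℕ+ → ℝ) :
    ∫⁻ ϑ, ∑' i, ENNReal.ofReal ((ϑ i - θ i) ^ 2) ∂componentMeasure p ε K I X ≤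
      ∑ i ∈ Finset.Iic I, ENNReal.ofReal (2 * noiseVar p ε i + 2 * (X i - θ i) ^ 2) +
        ENNReal.ofReal (2 * ∑' i : Set.Ioi I, θ i ^ 2) := by
  rw [lintegral_tsum fun i => Measurable.aemeasurable (by fun_prop)]
  have hterm : ∀ i, ∫⁻ ϑ, ENNReal.ofReal ((ϑ i - θ i) ^ 2) ∂componentMeasure p ε K I X ≤
      ENNReal.ofReal (2 * (if i ≤ I then K / (K + 1) * noiseVar p ε i else 0) +
        2 * (trunc I X i - θ i) ^ 2) := by
    intro i
    have h1 := (measurePreserving_eval_infinitePi (fun i : ℕ+ => gaussianReal (trunc I X i)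
      (if i ≤ I then K / (K + 1) * noiseVar p ε i else 0).toNNReal) i).lintegral_comp
      (f := fun x : ℝ => ENNReal.ofReal ((x - θ i) ^ 2)) (by fun_prop)
    refine (le_of_eq h1).trans ((lintegral_sq_sub_gaussianReal _ _ _).trans (le_of_eq ?_))
    rw [Real.coe_toNNReal]
    have := noiseVar_pos (p := p) hε i
    split_ifs <;> positivity
  refine (ENNReal.tsum_le_tsum hterm).trans ?_
  rw [← ENNReal.sum_add_tsum_compl (Finset.Iic I), Finset.coe_Iic, Set.compl_Iic]
  refine add_le_add (Finset.sum_le_sum fun i hi => ENNReal.ofReal_le_ofReal ?_) (le_of_eq ?_)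
  · have hi' := Finset.mem_Iic.mp hi
    rw [if_pos hi', trunc, if_pos hi']
    have hL : K / (K + 1) ≤ 1 := by rw [div_le_one (by linarith)]; linarith
    nlinarith [noiseVar_pos (p := p) hε i]
  · rw [← tsum_mul_left, ENNReal.ofReal_tsum_of_nonneg
      (f := fun i : Set.Ioi I => 2 * θ i ^ 2) (fun i => by positivity)
      (((summable_sq θ).subtype (Set.Ioi I)).mul_left 2)]
    refine tsum_congr fun i => ?_
    have hi : ¬ (i : ℕ+) ≤ I := not_le.mpr i.2
    rw [if_neg hi, trunc, if_neg hi]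
    simp

/-- The weight and `X i` are dependent, so the product is split by `w y ≤ eˢ w + e⁻ˢ y²`, balanced
for a weight of mean at most `e⁻²ˢ`. The fourth moment bound gives `132 = 4 + 2 * 64`. -/
lemma lintegral_weight_mul_noise_le {p ε s : ℝ} (hε : 0 < ε) (hs : 0 ≤ s) (θ : ℕ+ → ℝ) (i : ℕ+)
    {w R : (ℕ+ → ℝ) → ℝ} (hR : Measurable R)
    (hw : ∀ᵐ X ∂dataLaw p ε θ, 0 ≤ w X ∧ w X ≤ 1 ∧ w X ≤ R X)
    (hint : ∫⁻ X, ENNReal.ofReal (R X) ∂dataLaw p ε θ ≤ ENNReal.ofReal (Real.exp (-2 * s))) :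
    ∫⁻ X, ENNReal.ofReal (w X) * ENNReal.ofReal (2 * noiseVar p ε i + 2 * (X i - θ i) ^ 2)
        ∂dataLaw p ε θ ≤ ENNReal.ofReal (132 * Real.exp (-s) * noiseVar p ε i) := by
  have hv := noiseVar_pos (p := p) hε i
  set v := noiseVar p ε i with hvdef
  calc ∫⁻ X, ENNReal.ofReal (w X) * ENNReal.ofReal (2 * v + 2 * (X i - θ i) ^ 2) ∂dataLaw p ε θ
      ≤ ∫⁻ X, (ENNReal.ofReal (4 * v * Real.exp s) * ENNReal.ofReal (R X) +
          ENNReal.ofReal (2 * v * Real.exp (-s)) *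
            ENNReal.ofReal (((X i - θ i) ^ 2 / v) ^ 2)) ∂dataLaw p ε θ := by
        refine lintegral_mono_ae ?_
        filter_upwards [hw] with X hX
        obtain ⟨h0, h1, h2⟩ := hX
        have hR0 : 0 ≤ R X := h0.trans h2
        rw [← ENNReal.ofReal_mul h0, ← ENNReal.ofReal_mul (by positivity),
          ← ENNReal.ofReal_mul (by positivity), ← ENNReal.ofReal_add (by positivity)
          (by positivity)]
        refine ENNReal.ofReal_le_ofReal ?_
        set y := (X i - θ i) ^ 2 / v with hy
        have hyv : (X i - θ i) ^ 2 = v * y := by rw [hy]; field_simp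
        have hes : 1 ≤ Real.exp s := Real.one_le_exp hs
        have hexp : Real.exp s * Real.exp (-s) = 1 := by rw [← Real.exp_add]; simp
        have hpos := Real.exp_pos (-s)
        have hamgm : w X * y ≤ Real.exp s * w X + Real.exp (-s) * y ^ 2 := by
          have hq : 0 ≤ Real.exp (-s) * (Real.exp s * w X - y) ^ 2 := by positivity
          have hq2 : Real.exp (-s) * (Real.exp s * w X - y) ^ 2 =
              Real.exp s * w X ^ 2 - 2 * (w X * y) + Real.exp (-s) * y ^ 2 := by
            linear_combination (Real.exp s * w X ^ 2 - 2 * w X * y) * hexp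
          have hw2 : Real.exp s * w X ^ 2 ≤ Real.exp s * w X := by nlinarith
          have hnn : 0 ≤ Real.exp s * w X := by positivity
          have hnn2 : 0 ≤ Real.exp (-s) * y ^ 2 := by positivity
          linarith
        have hw3 : w X ≤ Real.exp s * w X := by nlinarith
        have hw4 : Real.exp s * w X ≤ Real.exp s * R X := by gcongr
        rw [hyv]
        have : w X * (1 + y) ≤ 2 * (Real.exp s * R X) + Real.exp (-s) * y ^ 2 := by linarith
        nlinarith
    _ ≤ ENNReal.ofReal (4 * v * Real.exp s) * ENNReal.ofReal (Real.exp (-2 * s)) +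
          ENNReal.ofReal (2 * v * Real.exp (-s)) * ENNReal.ofReal 64 := by
        rw [lintegral_add_left (by fun_prop), lintegral_const_mul _ (by fun_prop),
          lintegral_const_mul _ (by fun_prop)]
        gcongr
        exact lintegral_noise_pow_four_le hε θ i
    _ = ENNReal.ofReal (132 * Real.exp (-s) * v) := by
        rw [← ENNReal.ofReal_mul (by positivity), ← ENNReal.ofReal_mul (by positivity),
          ← ENNReal.ofReal_add (by positivity) (by positivity)]
        congr 1
        have : Real.exp s * Real.exp (-2 * s) = Real.exp (-s) := by
          rw [← Real.exp_add]; congr 1; ring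
        linear_combination 4 * v * this

/-- Excess bias of a smaller model against the bound on its posterior weight. -/
lemma excess_mul_exp_le {T v a : ℝ} (hv : 0 < v) :
    max (T - 8 * a * v) 0 * Real.exp (a - T / (4 * v)) ≤ 8 * v * Real.exp (-a) := by
  rcases le_total (T - 8 * a * v) 0 with h | h
  · rw [max_eq_right h, zero_mul]
    positivity
  · rw [max_eq_left h]
    -- In this variable the exponent is `-a - 2u`: the threshold `8av` is twice the break-even bias
    -- `4av`, leaving a spare `-a`.
    set u := (T - 8 * a * v) / (8 * v) with hu
    have hu0 : 0 ≤ u := by positivity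
    have hT : T - 8 * a * v = 8 * v * u := by rw [hu]; field_simp
    have hexp : a - T / (4 * v) = -a + -(2 * u) := by rw [hu]; field_simp; ring
    rw [hT, hexp, Real.exp_add, Real.exp_neg (2 * u)]
    have h1 : u * (Real.exp (2 * u))⁻¹ ≤ 1 := by
      rw [mul_inv_le_iff₀ (Real.exp_pos _)]
      linarith [Real.add_one_le_exp (2 * u)]
    calc 8 * v * u * (Real.exp (-a) * (Real.exp (2 * u))⁻¹)
        = 8 * v * Real.exp (-a) * (u * (Real.exp (2 * u))⁻¹) := by ring
      _ ≤ 8 * v * Real.exp (-a) * 1 := by gcongr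
      _ = _ := mul_one _

section Risk

variable {p ε K α h : ℝ} {θ : EllTwo} {I₀ : ℕ+}

/-- Contribution of the noise to the posterior risk. -/
lemma lintegral_noise_le (hp : 0 ≤ p) (hε : 0 < ε) (hK0 : 0 < K)
    (hK : 1 ≤ Real.log (K + 1)) (h0 : 0 < h) (h1 : h ≤ 1 / 2) (hα : 4 * h ≤ α)
    (hdom : ∀ I, I₀ ≤ I → ∑ i ∈ Finset.Ioc I₀ I, h⁻¹ * θ i ^ 2 ≤
      ∑ i ∈ Finset.Ioc I₀ I, noiseVar p ε i) :
    ∫⁻ X, ∑' I, ENNReal.ofReal (weight p ε K α I X) *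
        ∑ i ∈ Finset.Iic I, ENNReal.ofReal (2 * noiseVar p ε i + 2 * (X i - θ i) ^ 2)
        ∂dataLaw p ε θ ≤
      ENNReal.ofReal ((132 + 132 * ∑' d : ℕ, Real.exp (-(h * α / 4) * d) *
        (1 + (d : ℝ)) ^ (2 * p + 1)) * ∑ i ∈ Finset.Iic I₀, noiseVar p ε i) := by
  have hα0 : 0 < α := by linarith
  have hae := ae_summable_exp_logWeight hp hε hK h0 h1 hα hdom
  set N : ℕ+ → (ℕ+ → ℝ) → ℝ≥0∞ := fun I X =>
    ∑ i ∈ Finset.Iic I, ENNReal.ofReal (2 * noiseVar p ε i + 2 * (X i - θ i) ^ 2) with hN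
  have hNm : ∀ I, Measurable (N I) := fun I => by simp only [hN]; fun_prop
  have hwm := measurable_weight p ε K α
  have hs : 0 < h * α / 4 := by positivity
  have hsumm := summable_rpow_mul_exp hs (2 * p + 1)
  set S := ∑ i ∈ Finset.Iic I₀, noiseVar p ε i with hS
  have hS0 : 0 ≤ S := Finset.sum_nonneg fun i _ => (noiseVar_pos hε i).le
  have hnn : ∀ᵐ X ∂dataLaw p ε θ, ∀ I, 0 ≤ weight p ε K α I X := by
    filter_upwards [hae] with X hX I
    rw [weight_eq hK0 hα0 hε hX]
    exact div_nonneg (Real.exp_pos _).le (tsum_nonneg fun _ => (Real.exp_pos _).le)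
  have hbase : ∫⁻ X, N I₀ X ∂dataLaw p ε θ ≤ ENNReal.ofReal (132 * S) := by
    simp only [hN]
    rw [lintegral_finsetSum _ fun i _ => by fun_prop, hS, Finset.mul_sum,
      ENNReal.ofReal_sum_of_nonneg fun i _ => mul_nonneg (by norm_num) (noiseVar_pos hε i).le]
    refine Finset.sum_le_sum fun i _ => ?_
    simpa using lintegral_weight_mul_noise_le (p := p) hε le_rfl θ i (w := fun _ => 1)
      (R := fun _ => 1) measurable_const (by simp) (by simp)
  have hlarge : ∀ I : Set.Ioi I₀, ∫⁻ X, ENNReal.ofReal (weight p ε K α I X) * N I X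
      ∂dataLaw p ε θ ≤ ENNReal.ofReal (132 * S) * ENNReal.ofReal
        (Real.exp (-(h * α / 4) * (((I : ℕ+) : ℕ) - (I₀ : ℕ) : ℕ)) *
          (1 + ((((I : ℕ+) : ℕ) - (I₀ : ℕ) : ℕ) : ℝ)) ^ (2 * p + 1)) := by
    intro I
    have hI : I₀ ≤ (I : ℕ+) := I.2.le
    have hd : (0 : ℝ) ≤ ((I : ℕ+) : ℝ) - I₀ := sub_nonneg.mpr (by exact_mod_cast hI)
    have hRm : Measurable fun X : ℕ+ → ℝ =>
        Real.exp (h * (logWeight p ε K α X I - logWeight p ε K α X I₀)) := by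
      have ha := measurable_logWeight p ε K α (I : ℕ+)
      have hb := measurable_logWeight p ε K α I₀
      fun_prop
    simp only [hN, Finset.mul_sum]
    rw [lintegral_finsetSum _ fun i _ => by fun_prop,
      natCast_sub_of_mem, ← ENNReal.ofReal_mul (by positivity)]
    have hterm : ∀ i ∈ Finset.Iic (I : ℕ+), ∫⁻ X, ENNReal.ofReal (weight p ε K α I X) *
        ENNReal.ofReal (2 * noiseVar p ε i + 2 * (X i - θ i) ^ 2) ∂dataLaw p ε θ ≤
        ENNReal.ofReal (132 * Real.exp (-(h * α / 4 * (((I : ℕ+) : ℝ) - I₀))) *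
          noiseVar p ε i) := by
      intro i _
      refine lintegral_weight_mul_noise_le hε (by positivity) θ i hRm ?_ ?_
      · filter_upwards [hae, hnn] with X hX hX0
        exact ⟨hX0 I, weight_le_one hK0 hα0 hε hX I,
          weight_le_exp hK0 hα0 hε hX h0.le (by linarith) I I₀⟩
      · refine (lintegral_odds_larger_reference_le hp hε hK h0 h1 hα hdom hI).trans (le_of_eq ?_)
        congr 2
        ring
    refine (Finset.sum_le_sum hterm).trans ?_
    rw [← ENNReal.ofReal_sum_of_nonneg fun i _ => by have := noiseVar_pos (p := p) hε i; positivity,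
      ← Finset.mul_sum]
    refine ENNReal.ofReal_le_ofReal ?_
    calc 132 * Real.exp (-(h * α / 4 * (((I : ℕ+) : ℝ) - I₀))) *
          ∑ i ∈ Finset.Iic (I : ℕ+), noiseVar p ε i
        ≤ 132 * Real.exp (-(h * α / 4 * (((I : ℕ+) : ℝ) - I₀))) *
          ((1 + (((I : ℕ+) : ℝ) - I₀)) ^ (2 * p + 1) * S) := by
          gcongr
          exact sum_noiseVar_le hp hI
      _ = _ := by rw [neg_mul]; ring
  -- All models up to `I₀` together contribute at most the noise of `I₀`, as noise increases with
  -- the model and the weights sum to one.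
  have hpt : ∀ᵐ X ∂dataLaw p ε θ, ∑' I, ENNReal.ofReal (weight p ε K α I X) * N I X ≤
      N I₀ X + ∑' I : Set.Ioi I₀, ENNReal.ofReal (weight p ε K α I X) * N I X := by
    filter_upwards [hae] with X hX
    rw [← ENNReal.sum_add_tsum_compl (Finset.Iic I₀), Finset.coe_Iic, Set.compl_Iic]
    refine add_le_add ?_ le_rfl
    calc ∑ I ∈ Finset.Iic I₀, ENNReal.ofReal (weight p ε K α I X) * N I X
        ≤ ∑ I ∈ Finset.Iic I₀, ENNReal.ofReal (weight p ε K α I X) * N I₀ X := by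
          refine Finset.sum_le_sum fun I hI => mul_le_mul_right ?_ _
          exact Finset.sum_le_sum_of_subset (Finset.Iic_subset_Iic.mpr (Finset.mem_Iic.mp hI))
      _ ≤ 1 * N I₀ X := by
          rw [← Finset.sum_mul]
          refine mul_le_mul_left ?_ _
          rw [← tsum_ofReal_weight hK0 hα0 hε hX]
          exact ENNReal.sum_le_tsum _
      _ = N I₀ X := one_mul _
  refine (lintegral_mono_ae hpt).trans ?_
  rw [lintegral_add_left (hNm I₀), lintegral_tsum fun I : Set.Ioi I₀ =>
    Measurable.aemeasurable (by fun_prop)]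
  have htail := (ENNReal.tsum_le_tsum hlarge).trans (tsum_Ioi_le (fun d : ℕ =>
    ENNReal.ofReal (132 * S) * ENNReal.ofReal (Real.exp (-(h * α / 4) * d) *
      (1 + (d : ℝ)) ^ (2 * p + 1))) I₀)
  rw [ENNReal.tsum_mul_left, ← ENNReal.ofReal_tsum_of_nonneg (fun d => by positivity) hsumm,
    ← ENNReal.ofReal_mul (by positivity)] at htail
  refine (add_le_add hbase htail).trans (le_of_eq ?_)
  rw [← ENNReal.ofReal_add (by positivity)
    (mul_nonneg (by positivity) (tsum_nonneg fun d => by positivity))]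
  congr 1
  ring

/-- Contribution of the bias to the posterior risk. -/
lemma lintegral_bias_le (hp : 0 ≤ p) (hε : 0 < ε) (hK0 : 0 < K)
    (hK : 1 ≤ Real.log (K + 1)) (hα : 0 < α)
    (hae : ∀ᵐ X ∂dataLaw p ε θ, Summable fun J => Real.exp (logWeight p ε K α X J)) :
    ∫⁻ X, ∑' I, ENNReal.ofReal (weight p ε K α I X) *
        ENNReal.ofReal (2 * ∑' i : Set.Ioi I, θ i ^ 2) ∂dataLaw p ε θ ≤
      ENNReal.ofReal (2 * ∑' i : Set.Ioi I₀, θ i ^ 2 +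
        16 * (α + Real.log (K + 1) / 2 + 1) * ((2 * p + 1) *
          ∑ i ∈ Finset.Iic I₀, noiseVar p ε i)) := by
  set a := α + Real.log (K + 1) / 2 with ha
  have ha0 : 0 < a := by rw [ha]; linarith
  set v := noiseVar p ε I₀ with hv
  have hv0 : 0 < v := noiseVar_pos hε I₀
  have hI₀ : (0 : ℝ) < I₀ := by exact_mod_cast I₀.pos
  set B := ∑' i : Set.Ioi I₀, θ i ^ 2 with hB
  have hB0 : 0 ≤ B := tsum_nonneg fun i => sq_nonneg _
  have hwm := measurable_weight p ε K α
  set T : ℕ+ → ℝ := fun I => ∑ i ∈ Finset.Ioc I I₀, θ i ^ 2 with hT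
  -- Bias below the threshold goes into the deterministic `β`, using `I₀ - I ≤ I₀`; only the excess
  -- `E` has to be paid for by a small posterior weight.
  set E : ℕ+ → ℝ := fun I => max (T I - 8 * (a * ((I₀ : ℝ) - I)) * v) 0 with hE
  set β := 2 * B + 16 * a * (I₀ * v) with hβ
  have hβ0 : 0 ≤ β := by positivity
  have hsmall : ∀ I ≤ I₀, 2 * ∑' i : Set.Ioi I, θ i ^ 2 ≤ β + 2 * E I := by
    intro I hI
    rw [tail_eq_add θ hI]
    have h1 : T I - 8 * (a * ((I₀ : ℝ) - I)) * v ≤ E I := le_max_left _ _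
    have h2 : 0 ≤ a * I * v := by positivity
    simp only [hT] at h1
    nlinarith
  have hbig : ∀ I, I₀ < I → 2 * ∑' i : Set.Ioi I, θ i ^ 2 ≤ β := by
    intro I hI
    have h1 := tail_eq_add θ hI.le
    have h2 : 0 ≤ ∑ i ∈ Finset.Ioc I₀ I, θ i ^ 2 := Finset.sum_nonneg fun i _ => sq_nonneg _
    have h3 : 0 ≤ 16 * a * (I₀ * v) := by positivity
    linarith
  have hpt : ∀ᵐ X ∂dataLaw p ε θ, ∑' I, ENNReal.ofReal (weight p ε K α I X) *
        ENNReal.ofReal (2 * ∑' i : Set.Ioi I, θ i ^ 2) ≤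
      ENNReal.ofReal β + ∑ I ∈ Finset.Iic I₀,
        ENNReal.ofReal (weight p ε K α I X) * ENNReal.ofReal (2 * E I) := by
    filter_upwards [hae] with X hX
    have hle : ∀ I, ENNReal.ofReal (weight p ε K α I X) *
        ENNReal.ofReal (2 * ∑' i : Set.Ioi I, θ i ^ 2) ≤
        ENNReal.ofReal (weight p ε K α I X) * ENNReal.ofReal β +
        (if I ∈ Finset.Iic I₀ then
          ENNReal.ofReal (weight p ε K α I X) * ENNReal.ofReal (2 * E I) else 0) := by
      intro I
      split_ifs with hI
      · rw [← mul_add, ← ENNReal.ofReal_add hβ0 (by positivity)]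
        gcongr
        exact hsmall I (Finset.mem_Iic.mp hI)
      · rw [add_zero]
        gcongr
        exact hbig I (not_le.mp (by simpa using hI))
    refine (ENNReal.tsum_le_tsum hle).trans (le_of_eq ?_)
    rw [ENNReal.tsum_add, ENNReal.tsum_mul_right, tsum_ofReal_weight hK0 hα hε hX, one_mul,
      tsum_eq_sum (s := Finset.Iic I₀) (fun I hI => if_neg hI)]
    congr 1
    exact Finset.sum_congr rfl fun I hI => if_pos hI
  have hterm : ∀ I ∈ Finset.Iic I₀, ∫⁻ X, ENNReal.ofReal (weight p ε K α I X) *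
      ENNReal.ofReal (2 * E I) ∂dataLaw p ε θ ≤ ENNReal.ofReal (16 * v) := by
    intro I hI
    have hI' := Finset.mem_Iic.mp hI
    have hd : (0 : ℝ) ≤ (I₀ : ℝ) - I := sub_nonneg.mpr (by exact_mod_cast hI')
    have hE0 : 0 ≤ E I := le_max_right _ _
    rw [lintegral_mul_const _ (hwm I).ennreal_ofReal]
    have h1 : ∫⁻ X, ENNReal.ofReal (weight p ε K α I X) ∂dataLaw p ε θ ≤
        ENNReal.ofReal (Real.exp (a * ((I₀ : ℝ) - I) - T I / (4 * v))) := by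
      refine le_trans (lintegral_mono_ae ?_) (lintegral_odds_smaller_le (K := K) hp hε θ hI')
      filter_upwards [hae] with X hX
      exact ENNReal.ofReal_le_ofReal (weight_le_exp hK0 hα hε hX zero_le_one le_rfl I I₀)
    refine (mul_le_mul_left h1 _).trans ?_
    rw [← ENNReal.ofReal_mul (Real.exp_pos _).le]
    refine ENNReal.ofReal_le_ofReal ?_
    have h2 := excess_mul_exp_le (T := T I) (a := a * ((I₀ : ℝ) - I)) hv0
    have h3 : Real.exp (-(a * ((I₀ : ℝ) - I))) ≤ 1 := by
      rw [Real.exp_le_one_iff]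
      have := mul_nonneg ha0.le hd
      linarith
    have h4 : 8 * v * Real.exp (-(a * ((I₀ : ℝ) - I))) ≤ 8 * v * 1 := by gcongr
    simp only [hE]
    linarith
  refine (lintegral_mono_ae hpt).trans ?_
  rw [lintegral_add_left measurable_const, lintegral_const, measure_univ, mul_one,
    lintegral_finsetSum _ fun I _ => by fun_prop]
  -- The `I₀` smaller-or-equal models cost `16 v` each; this is the `+ 1` next to `a` in the bound.
  refine (add_le_add le_rfl (Finset.sum_le_card_nsmul _ _ _ hterm)).trans ?_
  have hcard : (Finset.Iic I₀).card = I₀ := by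
    have h1 : Finset.Iic I₀ = Finset.Icc 1 I₀ := by ext i; simp
    rw [h1, PNat.card_Icc]
    simp
  rw [hcard, ← ENNReal.ofReal_nsmul, ← ENNReal.ofReal_add hβ0 (by positivity), nsmul_eq_mul]
  refine ENNReal.ofReal_le_ofReal ?_
  have h5 := mul_noiseVar_le_sum (ε := ε) hp I₀
  rw [← hv] at h5
  have h6 := mul_le_mul_of_nonneg_left h5 (show 0 ≤ 16 * (a + 1) by positivity)
  rw [hβ]
  linarith

end Risk

/-! ### Markov's inequality and conclusion -/

lemma ddm_norm_ge_le {p ε K α r : ℝ} (hK : 0 < K) (hε : 0 < ε) (hr : 0 < r) (θ : EllTwo)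
    (X : ℕ+ → ℝ) :
    ddm p ε K α X {ϑ | ENNReal.ofReal r ≤ ellTwoNorm (fun i => ϑ i - θ i)} ≤
      (∑' I, ENNReal.ofReal (weight p ε K α I X) *
          ∑ i ∈ Finset.Iic I, ENNReal.ofReal (2 * noiseVar p ε i + 2 * (X i - θ i) ^ 2) +
        ∑' I, ENNReal.ofReal (weight p ε K α I X) *
          ENNReal.ofReal (2 * ∑' i : Set.Ioi I, θ i ^ 2)) / ENNReal.ofReal (r ^ 2) := by
  have hmeas : Measurable fun ϑ : ℕ+ → ℝ => ∑' i, ENNReal.ofReal ((ϑ i - θ i) ^ 2) :=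
    Measurable.tsum fun i => by fun_prop
  have hset : {ϑ : ℕ+ → ℝ | ENNReal.ofReal r ≤ ellTwoNorm (fun i => ϑ i - θ i)} ⊆
      {ϑ | ENNReal.ofReal (r ^ 2) ≤ ∑' i, ENNReal.ofReal ((ϑ i - θ i) ^ 2)} := by
    intro ϑ hϑ
    simp only [Set.mem_ofPred_eq, ellTwoNorm] at hϑ ⊢
    have h2 := ENNReal.rpow_le_rpow hϑ (show (0 : ℝ) ≤ 2 by norm_num)
    rw [← ENNReal.rpow_mul] at h2
    norm_num at h2
    rwa [← ENNReal.ofReal_pow hr.le] at h2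
  refine (measure_mono hset).trans ((meas_ge_le_lintegral_div hmeas.aemeasurable
    (by simpa using hr.ne') ENNReal.ofReal_ne_top).trans (ENNReal.div_le_div_right ?_ _))
  rw [ddm, lintegral_sum_measure, ← ENNReal.tsum_add]
  refine ENNReal.tsum_le_tsum fun I => ?_
  rw [lintegral_smul_measure, smul_eq_mul, ← mul_add]
  gcongr
  exact lintegral_componentMeasure_sq_le hK hε θ I X

end SignalDDM

theorem theorem3p1 (p K α : ℝ) (hp : 0 ≤ p) (hK : 1.87 ≤ K) (hα : 0 < α) :
    ∃ C : ℝ, ∀ ε : ℝ, 0 < ε →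
      Measurable (SignalDDM.ddm p ε K α) ∧
      ∀ θ₀ : SignalDDM.EllTwo,
        (∀ᵐ X ∂(SignalDDM.dataLaw p ε θ₀),
          (∀ I : ℕ+, Tendsto (fun n : ℕ+ => SignalDDM.weightUpTo p ε K α n I X) atTop
            (𝓝 (SignalDDM.weight p ε K α I X))) ∧
          IsProbabilityMeasure (SignalDDM.ddm p ε K α X) ∧
          ∀ᵐ ϑ ∂(SignalDDM.ddm p ε K α X), Memℓp ϑ 2) ∧
        ∀ M : ℝ, 0 < M →
          ∫⁻ X, SignalDDM.ddm p ε K α X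
              {ϑ | ENNReal.ofReal (M * SignalDDM.oracleRate p ε θ₀) ≤
                SignalDDM.ellTwoNorm (fun i => ϑ i - θ₀ i)}
            ∂(SignalDDM.dataLaw p ε θ₀) ≤ ENNReal.ofReal (C / M ^ 2) := by
  have hK0 : 0 < K := by linarith
  -- The threshold 1.87 enters here, through `e - 1 < 1.87`.
  have hlog : 1 ≤ Real.log (K + 1) := by
    rw [Real.le_log_iff_exp_le (by linarith)]
    linarith [Real.exp_one_lt_d9]
  -- The bound `1/2` controls `h/(2(1-h))` by `h/2 + h²`; the bound `α/4` lets the prior absorb the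
  -- second-order terms.
  set h : ℝ := min (1 / 2) (α / 4) with hh
  have h0 : 0 < h := lt_min (by norm_num) (by linarith)
  have h1 : h ≤ 1 / 2 := min_le_left _ _
  have hα4 : 4 * h ≤ α := by linarith [min_le_right (1 / 2) (α / 4)]
  set C₁ : ℝ := 132 + 132 * ∑' d : ℕ, Real.exp (-(h * α / 4) * d) * (1 + (d : ℝ)) ^ (2 * p + 1)
    with hC₁
  have hC₁0 : 0 ≤ C₁ := add_nonneg (by norm_num)
    (mul_nonneg (by norm_num) (tsum_nonneg fun d => by positivity))
  set C₂ : ℝ := 16 * (α + Real.log (K + 1) / 2 + 1) * (2 * p + 1) with hC₂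
  have hC₂0 : 0 ≤ C₂ := by positivity
  refine ⟨(C₁ + 2 + C₂) * h⁻¹, fun ε hε => ⟨SignalDDM.measurable_ddm p ε K α, fun θ => ?_⟩⟩
  obtain ⟨I₀, hdom, hrate⟩ := SignalDDM.exists_reference hp hε
    (show 1 ≤ h⁻¹ from (one_le_inv₀ h0).mpr (by linarith)) θ
  have hae := SignalDDM.ae_summable_exp_logWeight hp hε hlog h0 h1 hα4 hdom
  refine ⟨?_, fun M hM => ?_⟩
  · filter_upwards [hae] with X hX
    refine ⟨fun I => ?_, SignalDDM.isProbabilityMeasure_ddm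
      (SignalDDM.tsum_ofReal_weight hK0 hα hε hX), SignalDDM.ddm_ae_memℓp p ε K α X⟩
    rw [SignalDDM.weight_eq hK0 hα hε hX]
    exact SignalDDM.tendsto_weightUpTo hK0 hα hε hX I
  · have hr := SignalDDM.oracleRate_pos (p := p) hε θ
    set r := SignalDDM.oracleRate p ε θ with hrdef
    have hpos : 0 < (M * r) ^ 2 := by positivity
    refine (lintegral_mono fun X =>
      SignalDDM.ddm_norm_ge_le hK0 hε (mul_pos hM hr) θ X).trans ?_
    simp only [div_eq_mul_inv]
    have hwm := SignalDDM.measurable_weight p ε K α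
    rw [lintegral_mul_const' _ _ (by simpa using hpos.ne'), lintegral_add_left
      (Measurable.tsum fun I => by fun_prop), ← div_eq_mul_inv]
    refine (ENNReal.div_le_div_right (add_le_add
      (SignalDDM.lintegral_noise_le hp hε hK0 hlog h0 h1 hα4 hdom)
      (SignalDDM.lintegral_bias_le (I₀ := I₀) hp hε hK0 hlog hα hae)) _).trans ?_
    have hS : 0 ≤ ∑ i ∈ Finset.Iic I₀, SignalDDM.noiseVar p ε i :=
      Finset.sum_nonneg fun i _ => (SignalDDM.noiseVar_pos hε i).le
    have hB : 0 ≤ ∑' i : Set.Ioi I₀, θ i ^ 2 := tsum_nonneg fun i => sq_nonneg _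
    rw [← ENNReal.ofReal_add (by positivity) (by positivity), ← ENNReal.ofReal_div_of_pos hpos]
    refine ENNReal.ofReal_le_ofReal ?_
    rw [SignalDDM.rateSq] at hrate
    rw [← div_eq_mul_inv _ (M ^ 2), div_le_div_iff₀ hpos (by positivity), ← hC₁]
    set S := ∑ i ∈ Finset.Iic I₀, SignalDDM.noiseVar p ε i
    set B := ∑' i : Set.Ioi I₀, θ i ^ 2
    have hmain : C₁ * S + (2 * B + 16 * (α + Real.log (K + 1) / 2 + 1) * ((2 * p + 1) * S)) ≤
        (C₁ + 2 + C₂) * (h⁻¹ * r ^ 2) := by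
      have hstep : C₁ * S + (2 * B + C₂ * S) ≤ (C₁ + 2 + C₂) * (S + B) := by
        nlinarith [mul_nonneg hC₁0 hB, mul_nonneg hC₂0 hB]
      have := mul_le_mul_of_nonneg_left hrate (show 0 ≤ C₁ + 2 + C₂ by positivity)
      rw [hC₂] at hstep this ⊢
      linarith
    calc _ ≤ (C₁ + 2 + C₂) * (h⁻¹ * r ^ 2) * M ^ 2 := mul_le_mul_of_nonneg_right hmain (by positivity)
      _ = _ := by ring
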